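/- Let $n\ge 2$, let $\beta=(\beta_1,\dots,\beta_n)\in\mathbb{N}_0^n$ with $|\beta|=\beta_1+\dots+\beta_n\ge 1$, and write $\partial^\beta=\partial_{x_1}^{\beta_1}\cdots\partial_{x_n}^{\beta_n}$. Let $A,d\in\mathbb{N}_0$ and let $N_2>\beta_2,\dots,N_n>\beta_n$ be integers; in the single case $\beta=(1,0,\dots,0)$ let also an integer $N_1>1$ be given. A function is called single-signed on $X$ if it is $\ge 0$ on all of $X$ or $\le 0$ on all of $X$. A real polynomial $Q(x)=a_mx^m+\dots+a_0$ of degree $m$ is called semi-non-degenerating (SND) if $\max_j|a_{m-j}|=1$ and this maximum is attained for some $j\le m/2$. Then there is a function $C:\mathbb{R}\to\mathbb{R}$, depending only on $n,\beta,d,A$ and the $N_j$, and bounded above on $[0,R]$ for every $R$, with the following property. Let $X\subseteq\mathbb{R}^n$ be a bounded, (Lebesgue) measurable set such that for each $j\in\{2,\dots,n\}$, and also for $j=1$ if $\beta_1\ge 1$, and for all real $x_i$ ($i\ne j$), the slice $$\{y\in\mathbb{R}:(x_1,\dots,x_{j-1},y,x_{j+1},\dots,x_n)\in X\}$$ is a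 union of at most $A$ intervals. Let $f$ be a smooth real-valued function on an open neighbourhood of $X$ with $|\partial^\beta f|\ge 1$ on $X$, such that for each $j\in\{2,\dots,n\}$ the derivative $\partial^{(0,\dots,0,N_j,\beta_{j+1},\dots,\beta_n)}f$ (with $N_j$ in the $j$-th position) is single-signed on $X$; in the case $\beta=(1,0,\dots,0)$ assume in addition that $\partial_{x_1}^{N_1}f$ is single-signed on $X$. Then for every real polynomial $P$ of degree $d$ such that $P'$ is monic or SND, and every real $\lambda\ne 0$, $$\left|\int_X e^{i\lambda P(f(x))}\,dx\right|\le C(\operatorname{diam}X)\,|\lambda|^{-1/(|\beta|d)}.$$ -/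

import Mathlib

open scoped ContDiff

noncomputable section

namespace PolyPhase

/-- The partial derivative `∂_{x_j} f`. -/
def pderiv {n : ℕ} (j : Fin n) (f : EuclideanSpace ℝ (Fin n) → ℝ) :
    EuclideanSpace ℝ (Fin n) → ℝ :=
  fun x => fderiv ℝ f x (EuclideanSpace.single j 1)

/-- The mixed derivative `∂^β f = ∂_{x_1}^{β_1} (∂_{x_2}^{β_2} (⋯ ∂_{x_n}^{β_n} f))`. -/
def mderiv {n : ℕ} (β : Fin n → ℕ) (f : EuclideanSpace ℝ (Fin n) → ℝ) :
    EuclideanSpace ℝ (Fin n) → ℝ :=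
  (List.finRange n).foldr (fun j g => (pderiv j)^[β j] g) f

/-- The multiindex `(0, …, 0, N_j, β_{j+1}, …, β_n)`, with `N_j` in position `j`. -/
def tailIndex {n : ℕ} (β N : Fin n → ℕ) (j : Fin n) : Fin n → ℕ :=
  fun i => if i < j then 0 else if i = j then N j else β i

/-- `g ≥ 0` throughout `X`, or `g ≤ 0` throughout `X`. -/
def SingleSignedOn {E : Type*} (g : E → ℝ) (X : Set E) : Prop :=
  (∀ x ∈ X, 0 ≤ g x) ∨ (∀ x ∈ X, g x ≤ 0)

/-- `S` is a union of at most `A` intervals (of any kind: open, closed, half-open, degenerate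
to a point, or empty). -/
def IsUnionOfIntervals (A : ℕ) (S : Set ℝ) : Prop :=
  ∃ I : Fin A → Set ℝ, (∀ k, (I k).OrdConnected) ∧ S = ⋃ k, I k

/-- Every one-dimensional slice of `X` parallel to the `j`-th coordinate axis is a union of at
most `A` intervals. -/
def SlicesIn {n : ℕ} (j : Fin n) (A : ℕ) (X : Set (EuclideanSpace ℝ (Fin n))) : Prop :=
  ∀ x : Fin n → ℝ, IsUnionOfIntervals A {y : ℝ | WithLp.toLp 2 (Function.update x j y) ∈ X}

/-- Semi-non-degenerating polynomials: for `Q` of degree `d`, the largest absolute value of a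
coefficient is `1`, and it is attained at `x ^ (d - j)` for some `j ≤ d / 2`. -/
def IsSND (Q : Polynomial ℝ) : Prop :=
  (∀ i, |Q.coeff i| ≤ 1) ∧ ∃ j : ℕ, 2 * j ≤ Q.natDegree ∧ |Q.coeff (Q.natDegree - j)| = 1

end PolyPhase

end

/-!
The proof compares `X` with the set on which both `|∂_k f|` and `|P' ∘ f|` are bounded below, where
`k` is the last coordinate occurring in `β`. On each line parallel to the `k`-th axis that set is a
union of boundedly many intervals, because a higher derivative of `f` in the direction `k` is
single-signed, and van der Corput's first-derivative test applies there. The rest of `X` is small: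
by induction on `β`, peeling off the derivatives in the last direction first, `|f| < μ ^ |β|` holds
only on a set of measure `O(μ)`; this controls both `{|∂_k f| < μ ^ (|β| - 1)}` and, since a
polynomial that is monic or SND cannot be small on a whole interval, `{|P' ∘ f| < c μ ^ (|β| m)}`,
where `m` is the degree of `P'`. The two contributions balance at `|λ| μ ^ (|β| (m + 1)) = 1`.
-/

namespace PolyPhase

open Set MeasureTheory Filter
open scoped Topology

/-- `IntervalPartition p K S`: the set `S` is the union of at most `K` pairwise disjoint intervals
(of any kind), each satisfying `p`. Being inductive, it is closed under the two operations the
estimates need: refining every piece, and summing a bound over the pieces. -/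
inductive IntervalPartition (p : Set ℝ → Prop) : ℕ → Set ℝ → Prop
  | empty : IntervalPartition p 0 ∅
  | interval {S : Set ℝ} (hS : S.OrdConnected) (hp : p S) : IntervalPartition p 1 S
  | union {K L : ℕ} {S T : Set ℝ} (hS : IntervalPartition p K S) (hT : IntervalPartition p L T)
      (hd : Disjoint S T) : IntervalPartition p (K + L) (S ∪ T)
  | mono {K L : ℕ} {S : Set ℝ} (hS : IntervalPartition p K S) (hKL : K ≤ L) :
      IntervalPartition p L S

theorem ordConnected_inter_preimage {α β : Type*} [Preorder α] [Preorder β] {g : α → β}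
    {J : Set α} {I : Set β} (hJ : J.OrdConnected) (hI : I.OrdConnected)
    (hg : MonotoneOn g J ∨ AntitoneOn g J) : (J ∩ g ⁻¹' I).OrdConnected := by
  refine ⟨fun x hx y hy z hz => ?_⟩
  have hzJ : z ∈ J := hJ.out hx.1 hy.1 hz
  refine ⟨hzJ, ?_⟩
  rcases hg with hg | hg
  · exact hI.out hx.2 hy.2 ⟨hg hx.1 hzJ hz.1, hg hzJ hy.1 hz.2⟩
  · exact hI.out hy.2 hx.2 ⟨hg hzJ hy.1 hz.2, hg hx.1 hzJ hz.1⟩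

namespace IntervalPartition

variable {p q r : Set ℝ → Prop} {K L : ℕ} {R S : Set ℝ}

theorem bind_inter (h : IntervalPartition p K S)
    (H : ∀ J ⊆ S, J.OrdConnected → p J → IntervalPartition q L (J ∩ R)) :
    IntervalPartition q (K * L) (S ∩ R) := by
  induction h with
  | empty => simpa using empty
  | interval hS hp => simpa using H _ Subset.rfl hS hp
  | union _ _ hd ihS ihT =>
    rw [add_mul, union_inter_distrib_right]
    exact union (ihS fun J hJ => H J (hJ.trans subset_union_left))
      (ihT fun J hJ => H J (hJ.trans subset_union_right))
      (hd.mono inter_subset_left inter_subset_left)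
  | mono _ hKL ih => exact (ih H).mono (Nat.mul_le_mul_right L hKL)

theorem imp (h : IntervalPartition p K S)
    (H : ∀ J ⊆ S, J.OrdConnected → p J → q J) : IntervalPartition q K S := by
  simpa using h.bind_inter (L := 1) (R := univ) fun J hJS hJ hp => by
    simpa using interval hJ (H J hJS hJ hp)

theorem inter_preimage {g : ℝ → ℝ} (hS : IntervalPartition p K S) (hR : IntervalPartition q L R)
    (hg : ∀ J ⊆ S, J.OrdConnected → p J → MonotoneOn g J ∨ AntitoneOn g J)
    (H : ∀ J I, p J → q I → r (J ∩ g ⁻¹' I)) :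
    IntervalPartition r (K * L) (S ∩ g ⁻¹' R) := by
  refine hS.bind_inter fun J hJS hJ hp => ?_
  induction hR with
  | empty => simpa using empty
  | interval hI hq =>
    exact interval (ordConnected_inter_preimage hJ hI (hg J hJS hJ hp)) (H J _ hp hq)
  | union _ _ hd ih₁ ih₂ =>
    rw [preimage_union, inter_union_distrib_left]
    exact union ih₁ ih₂ ((hd.preimage g).mono inter_subset_right inter_subset_right)
  | mono _ hKL ih => exact ih.mono hKL

theorem measurableSet (h : IntervalPartition p K S) : MeasurableSet S := by
  induction h with
  | empty => exact .empty
  | interval hS _ => exact hS.measurableSet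
  | union _ _ _ ihS ihT => exact ihS.union ihT
  | mono _ _ ih => exact ih

theorem measure_inter_preimage_le {α : Type*} [MeasurableSpace α] {μ : Measure α} {g : α → ℝ}
    {Y : Set α} {M : ENNReal} (h : IntervalPartition p K S)
    (H : ∀ J ⊆ S, J.OrdConnected → p J → μ (Y ∩ g ⁻¹' J) ≤ M) :
    μ (Y ∩ g ⁻¹' S) ≤ K * M := by
  induction h with
  | empty => simp
  | interval hS hp => simpa using H _ Subset.rfl hS hp
  | union _ _ _ ihS ihT =>
    rw [preimage_union, inter_union_distrib_left, Nat.cast_add, add_mul]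
    exact (measure_union_le _ _).trans (add_le_add
      (ihS fun J hJ => H J (hJ.trans subset_union_left))
      (ihT fun J hJ => H J (hJ.trans subset_union_right)))
  | mono _ hKL ih => exact (ih H).trans (by gcongr)

theorem norm_setIntegral_le {E : Type*} [NormedAddCommGroup E] [NormedSpace ℝ E] {μ : Measure ℝ}
    {g : ℝ → E} {M : ℝ} (h : IntervalPartition p K S) (hM : 0 ≤ M) (hg : IntegrableOn g S μ)
    (H : ∀ J ⊆ S, J.OrdConnected → p J → ‖∫ t in J, g t ∂μ‖ ≤ M) :
    ‖∫ t in S, g t ∂μ‖ ≤ K * M := by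
  induction h with
  | empty => simp
  | interval hS hp => simpa using H _ Subset.rfl hS hp
  | union _ hT hd ihS ihT =>
    have hgS := hg.mono_set subset_union_left
    have hgT := hg.mono_set subset_union_right
    rw [setIntegral_union hd hT.measurableSet hgS hgT, Nat.cast_add, add_mul]
    exact (norm_add_le _ _).trans (add_le_add
      (ihS hgS fun J hJ => H J (hJ.trans subset_union_left))
      (ihT hgT fun J hJ => H J (hJ.trans subset_union_right)))
  | mono _ hKL ih => exact (ih hg H).trans (by gcongr)

theorem iUnion_ordConnectedComponent (S : Set ℝ) (F : Finset ℝ) :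
    IntervalPartition (fun _ => True) F.card (⋃ x ∈ F, ordConnectedComponent S x) := by
  induction F using Finset.induction_on with
  | empty => simpa using empty
  | insert x F hx ih =>
    rw [Finset.card_insert_of_notMem hx, Finset.set_biUnion_insert, add_comm]
    by_cases hd : Disjoint (ordConnectedComponent S x) (⋃ y ∈ F, ordConnectedComponent S y)
    · exact union (interval inferInstance trivial) ih hd
    · obtain ⟨z, hzx, hz⟩ := not_disjoint_iff.1 hd
      obtain ⟨y, hy, hzy⟩ := mem_iUnion₂.1 hz
      have hxy : ordConnectedComponent S x = ordConnectedComponent S y :=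
        (ordConnectedComponent_eq hzx).trans (ordConnectedComponent_eq hzy).symm
      rw [union_eq_self_of_subset_left (hxy ▸ subset_biUnion_of_mem hy)]
      exact ih.mono (Nat.le_add_left _ _)

theorem univ_sign :
    IntervalPartition (fun I => (∀ y ∈ I, 0 ≤ y) ∨ ∀ y ∈ I, y ≤ 0) 2 (univ : Set ℝ) := by
  rw [← Ici_union_Iio (a := (0 : ℝ))]
  exact union (interval ordConnected_Ici (.inl fun y hy => hy))
    (interval ordConnected_Iio (.inr fun y hy => (mem_Iio.1 hy).le))
    (disjoint_left.2 fun y hy hy' => (mem_Iio.1 hy').not_ge hy)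

theorem le_abs {δ : ℝ} (hδ : 0 < δ) :
    IntervalPartition (fun I => ∀ y ∈ I, δ ≤ |y|) 2 {y | δ ≤ |y|} := by
  have hunion : {y : ℝ | δ ≤ |y|} = Ici δ ∪ Iic (-δ) := by
    ext y
    simp only [mem_ofPred_eq, _root_.le_abs, le_neg, mem_union, mem_Ici, mem_Iic]
  rw [hunion]
  refine union (interval ordConnected_Ici fun y hy => le_abs_self y |>.trans' hy)
    (interval ordConnected_Iic fun y hy => (neg_le_abs y).trans' (le_neg.1 hy)) ?_
  exact disjoint_left.2 fun y hy hy' => by linarith [mem_Ici.1 hy, mem_Iic.1 hy']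

theorem abs_lt (δ : ℝ) :
    IntervalPartition (fun I => ∀ y ∈ I, |y| < δ) 1 {y | |y| < δ} := by
  refine interval ?_ fun y hy => hy
  simp only [_root_.abs_lt]
  exact ordConnected_Ioo

end IntervalPartition

theorem IsUnionOfIntervals.intervalPartition {A : ℕ} {S : Set ℝ} (h : IsUnionOfIntervals A S) :
    IntervalPartition (fun _ => True) A S := by
  obtain ⟨I, hI, hS⟩ := h
  have hIS : ∀ k, I k ⊆ S := fun k => hS ▸ subset_iUnion I k
  have hx : ∀ k, ∃ x, (I k).Nonempty → x ∈ I k := fun k => by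
    by_cases hk : (I k).Nonempty
    exacts [⟨hk.some, fun _ => hk.some_mem⟩, ⟨0, fun h => absurd h hk⟩]
  choose x hx using hx
  have hcover : S = ⋃ y ∈ Finset.univ.image x, ordConnectedComponent S y := by
    refine Subset.antisymm (fun t ht => ?_)
      (iUnion₂_subset fun _ _ => ordConnectedComponent_subset)
    obtain ⟨k, hk⟩ := mem_iUnion.1 (hS ▸ ht)
    haveI : (I k).OrdConnected := hI k
    exact mem_iUnion₂.2 ⟨x k, Finset.mem_image_of_mem x (Finset.mem_univ k),
      subset_ordConnectedComponent (hx k ⟨t, hk⟩) (hIS k) hk⟩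
  rw [hcover]
  exact (IntervalPartition.iUnion_ordConnectedComponent S _).mono
    (Finset.card_image_le.trans (by simp))

/-- A sequence of real functions, each the derivative of the previous one at the points of `S`. -/
def DerivChainOn (h : ℕ → ℝ → ℝ) (S : Set ℝ) : Prop :=
  ∀ t ∈ S, ∀ i, HasDerivAt (h i) (h (i + 1) t) t

section DerivChain

variable {h : ℕ → ℝ → ℝ} {S T : Set ℝ}

theorem DerivChainOn.mono (hh : DerivChainOn h S) (hT : T ⊆ S) : DerivChainOn h T :=
  fun t ht => hh t (hT ht)

theorem DerivChainOn.tail (hh : DerivChainOn h S) : DerivChainOn (fun i => h (i + 1)) S :=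
  fun t ht i => hh t ht (i + 1)

theorem DerivChainOn.continuousOn (hh : DerivChainOn h S) (i : ℕ) : ContinuousOn (h i) S :=
  fun t ht => (hh t ht i).continuousAt.continuousWithinAt

theorem SingleSignedOn.mono {E : Type*} {g : E → ℝ} {X Y : Set E} (hg : SingleSignedOn g Y)
    (hXY : X ⊆ Y) : SingleSignedOn g X :=
  hg.imp (fun hg x hx => hg x (hXY hx)) fun hg x hx => hg x (hXY hx)

theorem singleSignedOn_of_ne_zero {g : ℝ → ℝ} {J : Set ℝ} (hJ : J.OrdConnected)
    (hg : ContinuousOn g J) (h0 : ∀ t ∈ J, g t ≠ 0) : SingleSignedOn g J := by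
  by_contra hns
  rw [SingleSignedOn, not_or] at hns
  push Not at hns
  obtain ⟨⟨a, ha, hga⟩, b, hb, hgb⟩ := hns
  obtain ⟨t, ht, hgt⟩ := hJ.isPreconnected.intermediate_value ha hb hg ⟨hga.le, hgb.le⟩
  exact h0 t ht hgt

theorem DerivChainOn.monotoneOn_or_antitoneOn {J : Set ℝ} (hh : DerivChainOn h J)
    (hJ : J.OrdConnected) {i : ℕ} (hs : SingleSignedOn (h (i + 1)) J) :
    MonotoneOn (h i) J ∨ AntitoneOn (h i) J :=
  hs.imp
    (fun hs => monotoneOn_of_hasDerivWithinAt_nonneg hJ.convex (hh.continuousOn i)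
      (fun t ht => (hh t (interior_subset ht) i).hasDerivWithinAt)
      fun t ht => hs t (interior_subset ht))
    fun hs => antitoneOn_of_hasDerivWithinAt_nonpos hJ.convex (hh.continuousOn i)
      (fun t ht => (hh t (interior_subset ht) i).hasDerivWithinAt)
      fun t ht => hs t (interior_subset ht)

theorem IntervalPartition.singleSigned {p : Set ℝ → Prop} {K N : ℕ}
    (hS : IntervalPartition p K S) (hh : DerivChainOn h S)
    (hs : ∀ J ⊆ S, J.OrdConnected → SingleSignedOn (h N) J) :
    IntervalPartition (fun J => ∀ i ≤ N, SingleSignedOn (h i) J) (K * 2 ^ N) S := by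
  induction N generalizing h with
  | zero =>
    rw [pow_zero, mul_one]
    exact hS.imp fun J hJS hJ _ i hi => Nat.le_zero.1 hi ▸ hs J hJS hJ
  | succ N ih =>
    rw [← inter_univ S, ← preimage_univ (f := h 0), pow_succ, ← mul_assoc]
    refine (ih hh.tail hs).inter_preimage univ_sign
      (fun J hJS hJ hJs => (hh.mono hJS).monotoneOn_or_antitoneOn hJ (hJs 0 N.zero_le))
      fun J I hJs hI i hi => ?_
    rcases i with _ | i
    · exact hI.imp (fun hI t ht => hI _ ht.2) fun hI t ht => hI _ ht.2
    · exact (hJs i (Nat.succ_le_succ_iff.1 hi)).mono inter_subset_left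

end DerivChain

theorem DerivChainOn.exists_abs_mul_pow_le (k : ℕ) : ∃ C : ℝ, 1 ≤ C ∧
    ∀ (h : ℕ → ℝ → ℝ) (a b δ : ℝ), a < b → DerivChainOn h (Icc a b) →
      (∀ t ∈ Icc a b, |h 0 t| ≤ δ) → ∃ ξ ∈ Icc a b, |h k ξ| * (b - a) ^ k ≤ C * δ := by
  induction k with
  | zero =>
    refine ⟨1, le_rfl, fun h a b δ hab _ hδ => ⟨a, left_mem_Icc.2 hab.le, ?_⟩⟩
    simpa using hδ a (left_mem_Icc.2 hab.le)
  | succ k ih =>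
    obtain ⟨C, hC, H⟩ := ih
    refine ⟨2 * 3 ^ (k + 1) * C, by nlinarith [one_le_pow₀ (n := k + 1) (one_le_two.trans
      (by norm_num : (2 : ℝ) ≤ 3))], fun h a b δ hab hh hδ => ?_⟩
    -- Slope of `h k` between points in the outer thirds where it is small.
    set ℓ := (b - a) / 3 with hℓ
    have hleft : Icc a (a + ℓ) ⊆ Icc a b := Icc_subset_Icc le_rfl (by linarith)
    have hright : Icc (b - ℓ) b ⊆ Icc a b := Icc_subset_Icc (by linarith) le_rfl
    obtain ⟨x, hx, hxk⟩ := H h a (a + ℓ) δ (by linarith) (hh.mono hleft)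
      fun t ht => hδ t (hleft ht)
    obtain ⟨y, hy, hyk⟩ := H h (b - ℓ) b δ (by linarith) (hh.mono hright)
      fun t ht => hδ t (hright ht)
    rw [add_sub_cancel_left] at hxk
    rw [sub_sub_cancel] at hyk
    have hxy : ℓ ≤ y - x := by linarith [hx.2, hy.1]
    have hsub : Icc x y ⊆ Icc a b := Icc_subset_Icc hx.1 hy.2
    obtain ⟨ξ, hξ, hslope⟩ := exists_hasDerivAt_eq_slope (h k) (h (k + 1)) (by linarith)
      ((hh.mono hsub).continuousOn k) fun t ht => hh t (hsub (Ioo_subset_Icc_self ht)) k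
    have hξℓ : |h (k + 1) ξ| * ℓ ≤ |h k y| + |h k x| := calc
      |h (k + 1) ξ| * ℓ ≤ |h (k + 1) ξ| * |y - x| := by
        gcongr
        exact hxy.trans (le_abs_self _)
      _ = |h k y - h k x| := by
        rw [← abs_mul, hslope, div_mul_cancel₀ _ (by linarith)]
      _ ≤ |h k y| + |h k x| := abs_sub _ _
    refine ⟨ξ, hsub (Ioo_subset_Icc_self hξ), ?_⟩
    calc |h (k + 1) ξ| * (b - a) ^ (k + 1)
        = 3 ^ (k + 1) * (|h (k + 1) ξ| * ℓ * ℓ ^ k) := by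
          rw [show b - a = 3 * ℓ by rw [hℓ]; ring, mul_pow, pow_succ ℓ]
          ring
      _ ≤ 3 ^ (k + 1) * ((|h k y| + |h k x|) * ℓ ^ k) := by
          have : 0 ≤ ℓ := by linarith
          gcongr
      _ ≤ 3 ^ (k + 1) * (C * δ + C * δ) := by
          rw [add_mul]
          gcongr
      _ = 2 * 3 ^ (k + 1) * C * δ := by ring

theorem DerivChainOn.exists_volume_interval_le (k : ℕ) : ∃ C : ℝ, 1 ≤ C ∧
    ∀ (h : ℕ → ℝ → ℝ) (J : Set ℝ) (δ μ : ℝ), J.OrdConnected → DerivChainOn h J → 0 < δ → 0 ≤ μ →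
      (∀ t ∈ J, δ ≤ |h k t|) → (∀ t ∈ J, |h 0 t| < δ * μ ^ k) →
      volume J ≤ ENNReal.ofReal (C * μ) := by
  obtain ⟨C, hC, H⟩ := exists_abs_mul_pow_le k
  refine ⟨C, hC, fun h J δ μ hJ hh hδ hμ hlower hupper => ?_⟩
  refine (Real.volume_le_diam J).trans (Metric.ediam_le_of_forall_dist_le fun x hx y hy => ?_)
  wlog hxy : x < y generalizing x y
  · rcases eq_or_lt_of_le (not_lt.1 hxy) with h | h
    · rw [h, dist_self]
      positivity
    · rw [dist_comm]
      exact this y hy x hx h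
  have hsub : Icc x y ⊆ J := hJ.out hx hy
  obtain ⟨ξ, hξ, hle⟩ := H h x y (δ * μ ^ k) hxy (hh.mono hsub) fun t ht => (hupper t (hsub ht)).le
  have hk : k ≠ 0 := by
    rintro rfl
    exact absurd ((hlower x hx).trans_lt (hupper x hx)) (by simp)
  have hpow : (y - x) ^ k ≤ (C * μ) ^ k := by
    refine le_of_mul_le_mul_left (?_ : δ * (y - x) ^ k ≤ δ * (C * μ) ^ k) hδ
    calc δ * (y - x) ^ k ≤ |h k ξ| * (y - x) ^ k := by
          have := sub_nonneg.2 hxy.le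
          gcongr
          exact hlower ξ (hsub hξ)
      _ ≤ C * (δ * μ ^ k) := hle
      _ ≤ C ^ k * (δ * μ ^ k) := by
          gcongr
          exact le_self_pow₀ hC hk
      _ = δ * (C * μ) ^ k := by
          rw [mul_pow, mul_left_comm]
  rw [dist_comm, Real.dist_eq, abs_of_pos (sub_pos.2 hxy)]
  exact le_of_pow_le_pow_left₀ hk (by positivity) hpow

theorem exists_volume_sublevel_le_of_forall_le_abs (K k : ℕ) : ∃ C : ℝ, 0 ≤ C ∧
    ∀ (p : Set ℝ → Prop) (S : Set ℝ) (h : ℕ → ℝ → ℝ) (δ μ : ℝ), IntervalPartition p K S →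
      DerivChainOn h S → 0 < δ → 0 ≤ μ → (∀ t ∈ S, δ ≤ |h k t|) →
      volume (S ∩ {t | |h 0 t| < δ * μ ^ k}) ≤ ENNReal.ofReal (C * μ) := by
  obtain ⟨C, hC, H⟩ := DerivChainOn.exists_volume_interval_le k
  refine ⟨(K * 2 ^ k * 1 : ℕ) * C, by positivity, fun p S h δ μ hS hh hδ hμ hlower => ?_⟩
  rcases k.eq_zero_or_pos with rfl | hk
  · have hempty : S ∩ {t | |h 0 t| < δ * μ ^ 0} = ∅ := by
      refine eq_empty_of_forall_notMem fun t ht => ?_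
      simpa using (hlower t ht.1).trans_lt ht.2
    rw [hempty, measure_empty]
    exact zero_le
  · have hsigned := hS.singleSigned (N := k) hh fun J hJS hJ =>
      singleSignedOn_of_ne_zero hJ ((hh.mono hJS).continuousOn k)
        fun t ht => abs_pos.1 (hδ.trans_le (hlower t (hJS ht)))
    have hpart := hsigned.inter_preimage (r := fun _ => True) (.abs_lt (δ * μ ^ k))
      (fun J hJS hJ hJs => (hh.mono hJS).monotoneOn_or_antitoneOn hJ (hJs 1 hk))
      fun _ _ _ _ => trivial
    rw [mul_assoc, ENNReal.ofReal_mul (Nat.cast_nonneg _), ENNReal.ofReal_natCast]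
    simpa using hpart.measure_inter_preimage_le (μ := volume) (Y := univ) (g := id)
      fun J hJS hJ _ => by
        simpa using H h J δ μ hJ (hh.mono fun t ht => (hJS ht).1) hδ hμ
          (fun t ht => hlower t (hJS ht).1) fun t ht => (hJS ht).2

theorem exists_volume_sublevel_le_of_singleSigned (K : ℕ) {k N : ℕ} (hkN : k < N) :
    ∃ C : ℝ, 0 ≤ C ∧ ∀ (p : Set ℝ → Prop) (S : Set ℝ) (h : ℕ → ℝ → ℝ) (δ μ : ℝ),
      IntervalPartition p K S → DerivChainOn h S →
      (∀ J ⊆ S, J.OrdConnected → SingleSignedOn (h N) J) → 0 < δ → 0 ≤ μ →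
      volume (S ∩ {t | δ ≤ |h k t|} ∩ {t | |h 0 t| < δ * μ ^ k}) ≤ ENNReal.ofReal (C * μ) := by
  obtain ⟨C, hC, H⟩ := exists_volume_sublevel_le_of_forall_le_abs (K * 2 ^ N * 2) k
  refine ⟨C, hC, fun p S h δ μ hS hh hs hδ hμ => ?_⟩
  have hpart := (hS.singleSigned hh hs).inter_preimage (r := fun _ => True) (.le_abs hδ)
    (fun J hJS hJ hJs => (hh.mono hJS).monotoneOn_or_antitoneOn hJ (hJs (k + 1) hkN))
    fun _ _ _ _ => trivial
  exact H _ _ h δ μ hpart (hh.mono inter_subset_left) hδ hμ fun t ht => ht.2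

theorem SingleSignedOn.neg {E : Type*} {f : E → ℝ} {X : Set E} (hf : SingleSignedOn f X) :
    SingleSignedOn (fun x => -f x) X :=
  hf.symm.imp (fun hf x hx => neg_nonneg.2 (hf x hx)) fun hf x hx => neg_nonpos.2 (hf x hx)

theorem SingleSignedOn.mul {E : Type*} {f g : E → ℝ} {X : Set E} (hf : SingleSignedOn f X)
    (hg : SingleSignedOn g X) : SingleSignedOn (fun x => f x * g x) X := by
  rcases hf with hf | hf <;> rcases hg with hg | hg
  · exact .inl fun x hx => mul_nonneg (hf x hx) (hg x hx)
  · exact .inr fun x hx => mul_nonpos_of_nonneg_of_nonpos (hf x hx) (hg x hx)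
  · exact .inr fun x hx => mul_nonpos_of_nonpos_of_nonneg (hf x hx) (hg x hx)
  · exact .inl fun x hx => mul_nonneg_of_nonpos_of_nonpos (hf x hx) (hg x hx)

theorem singleSignedOn_const {E : Type*} (c : ℝ) (X : Set E) : SingleSignedOn (fun _ => c) X :=
  (le_total 0 c).imp (fun hc _ _ => hc) fun hc _ _ => hc

theorem norm_cexp_I_mul_ofReal (x : ℝ) : ‖Complex.exp (Complex.I * x)‖ = 1 := by
  rw [mul_comm, Complex.norm_exp_ofReal_mul_I]

/-- `u` has the continuous and single-signed derivative `u'` on `J`: the class of functions whose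
total variation on an interval is controlled by their size. -/
structure HasSignedDerivOn (u u' : ℝ → ℝ) (J : Set ℝ) : Prop where
  hasDerivAt : ∀ t ∈ J, HasDerivAt u (u' t) t
  continuousOn_deriv : ContinuousOn u' J
  singleSignedOn_deriv : SingleSignedOn u' J

theorem HasSignedDerivOn.continuousOn {u u' : ℝ → ℝ} {J : Set ℝ} (hu : HasSignedDerivOn u u' J) :
    ContinuousOn u J :=
  HasDerivAt.continuousOn hu.hasDerivAt

theorem HasSignedDerivOn.inv {u u' : ℝ → ℝ} {J : Set ℝ} (hu : HasSignedDerivOn u u' J)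
    (h0 : ∀ t ∈ J, u t ≠ 0) :
    HasSignedDerivOn (fun t => (u t)⁻¹) (fun t => -u' t / u t ^ 2) J where
  hasDerivAt t ht := (hu.hasDerivAt t ht).inv (h0 t ht)
  continuousOn_deriv := hu.continuousOn_deriv.neg.div (hu.continuousOn.pow 2)
    fun t ht => pow_ne_zero _ (h0 t ht)
  singleSignedOn_deriv := hu.singleSignedOn_deriv.neg.mul (g := fun t => (u t ^ 2)⁻¹)
    (.inl fun t _ => by positivity)

section VanDerCorput

variable {a b : ℝ} {u u' v v' : ℝ → ℝ} {B D : ℝ}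

theorem HasSignedDerivOn.integral_abs_deriv_le (hu : HasSignedDerivOn u u' (Icc a b))
    (hab : a ≤ b) (hB : ∀ t ∈ Icc a b, |u t| ≤ B) : ∫ t in a..b, |u' t| ≤ 2 * B := by
  rw [← uIcc_of_le hab] at hu hB
  have hftc : ∫ t in a..b, u' t = u b - u a :=
    intervalIntegral.integral_eq_sub_of_hasDerivAt hu.hasDerivAt
      hu.continuousOn_deriv.intervalIntegrable
  have ha := abs_le.1 (hB a left_mem_uIcc)
  have hb := abs_le.1 (hB b right_mem_uIcc)
  rcases hu.singleSignedOn_deriv with hs | hs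
  · rw [intervalIntegral.integral_congr fun t ht => abs_of_nonneg (hs t ht), hftc]
    linarith
  · rw [intervalIntegral.integral_congr fun t ht => abs_of_nonpos (hs t ht),
      intervalIntegral.integral_neg, hftc]
    linarith

theorem HasSignedDerivOn.integral_abs_deriv_mul_le (hu : HasSignedDerivOn u u' (Icc a b))
    (hv : HasSignedDerivOn v v' (Icc a b)) (hab : a ≤ b) (hB : ∀ t ∈ Icc a b, |u t| ≤ B)
    (hD : ∀ t ∈ Icc a b, |v t| ≤ D) : ∫ t in a..b, |u' t * v t + u t * v' t| ≤ 4 * (B * D) := by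
  have hB0 : 0 ≤ B := (abs_nonneg _).trans (hB a (left_mem_Icc.2 hab))
  have hD0 : 0 ≤ D := (abs_nonneg _).trans (hD a (left_mem_Icc.2 hab))
  have hint : ∀ g : ℝ → ℝ, ContinuousOn g (Icc a b) → IntervalIntegrable g volume a b :=
    fun g hg => (uIcc_of_le hab ▸ hg : ContinuousOn g (uIcc a b)).intervalIntegrable
  have hu'v := hint (fun t => |u' t| * D) (hu.continuousOn_deriv.abs.mul continuousOn_const)
  have huv' := hint (fun t => B * |v' t|) (continuousOn_const.mul hv.continuousOn_deriv.abs)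
  calc ∫ t in a..b, |u' t * v t + u t * v' t|
      ≤ ∫ t in a..b, (|u' t| * D + B * |v' t|) := by
        refine intervalIntegral.integral_mono_on hab (hint _ ((hu.continuousOn_deriv.mul
          hv.continuousOn).add (hu.continuousOn.mul hv.continuousOn_deriv)).abs)
          (hu'v.add huv') fun t ht => (abs_add_le _ _).trans ?_
        rw [abs_mul, abs_mul]
        gcongr
        exacts [hD t ht, hB t ht]
    _ = (∫ t in a..b, |u' t|) * D + B * ∫ t in a..b, |v' t| := by
        rw [intervalIntegral.integral_add hu'v huv', intervalIntegral.integral_mul_const,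
          intervalIntegral.integral_const_mul]
    _ ≤ 2 * B * D + B * (2 * D) := by
        gcongr
        exacts [hu.integral_abs_deriv_le hab hB, hv.integral_abs_deriv_le hab hD]
    _ = 4 * (B * D) := by ring

theorem norm_integral_cexp_le {φ φ' w w' : ℝ → ℝ} (hab : a ≤ b)
    (hφ : ∀ t ∈ Icc a b, HasDerivAt φ (φ' t) t) (hφ'c : ContinuousOn φ' (Icc a b))
    (hw : ∀ t ∈ Icc a b, HasDerivAt w (w' t) t) (hw'c : ContinuousOn w' (Icc a b))
    (hwφ : ∀ t ∈ Icc a b, w t * φ' t = 1) :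
    ‖∫ t in a..b, Complex.exp (Complex.I * φ t)‖ ≤ |w a| + |w b| + ∫ t in a..b, |w' t| := by
  have huIcc : uIcc a b = Icc a b := uIcc_of_le hab
  set E : ℝ → ℂ := fun t => Complex.exp (Complex.I * φ t)
  have hE : ∀ t ∈ Icc a b, HasDerivAt E (E t * (Complex.I * φ' t)) t := fun t ht =>
    ((hφ t ht).ofReal_comp.const_mul Complex.I).cexp
  have hE' : ContinuousOn (fun t => E t * (Complex.I * φ' t)) (Icc a b) :=
    (HasDerivAt.continuousOn hE).mul (continuousOn_const.mul
      (Complex.continuous_ofReal.comp_continuousOn hφ'c))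
  have hnorm : ∀ (x t : ℝ), ‖(x : ℂ) * E t‖ = |x| := fun x t => by
    rw [norm_mul, norm_cexp_I_mul_ofReal, mul_one, Complex.norm_real, Real.norm_eq_abs]
  have hparts := intervalIntegral.integral_mul_deriv_eq_deriv_mul (a := a) (b := b)
    (u := fun t => (w t : ℂ)) (v := E) (u' := fun t => (w' t : ℂ))
    (fun t ht => (hw t (huIcc ▸ ht)).ofReal_comp) (fun t ht => hE t (huIcc ▸ ht))
    (Complex.continuous_ofReal.comp_continuousOn (huIcc ▸ hw'c)).intervalIntegrable
    (huIcc ▸ hE' : ContinuousOn _ (uIcc a b)).intervalIntegrable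
  have hleft : ∫ t in a..b, (w t : ℂ) * (E t * (Complex.I * φ' t)) =
      Complex.I * ∫ t in a..b, E t := by
    rw [← intervalIntegral.integral_const_mul]
    refine intervalIntegral.integral_congr fun t ht => ?_
    have h1 : (w t : ℂ) * φ' t = 1 := by exact_mod_cast hwφ t (huIcc ▸ ht)
    linear_combination (Complex.I * E t) * h1
  calc ‖∫ t in a..b, E t‖ = ‖Complex.I * ∫ t in a..b, E t‖ := by simp
    _ = ‖(w b : ℂ) * E b - w a * E a - ∫ t in a..b, (w' t : ℂ) * E t‖ := by
        rw [← hleft, hparts]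
    _ ≤ ‖(w b : ℂ) * E b‖ + ‖(w a : ℂ) * E a‖ + ‖∫ t in a..b, (w' t : ℂ) * E t‖ :=
        norm_sub_le_of_le (norm_sub_le _ _) le_rfl
    _ ≤ |w a| + |w b| + ∫ t in a..b, |w' t| := by
        rw [hnorm, hnorm, add_comm |w b|]
        gcongr
        simpa only [hnorm] using intervalIntegral.norm_integral_le_integral_norm
          (f := fun t => (w' t : ℂ) * E t) hab

theorem norm_integral_cexp_le_of_deriv_eq_mul {φ p q p' q' : ℝ → ℝ} {r s : ℝ} (hab : a ≤ b)
    (hr : 0 < r) (hs : 0 < s) (hφ : ∀ t ∈ Icc a b, HasDerivAt φ (p t * q t) t)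
    (hp : HasSignedDerivOn p p' (Icc a b)) (hpr : ∀ t ∈ Icc a b, r ≤ |p t|)
    (hq : HasSignedDerivOn q q' (Icc a b)) (hqs : ∀ t ∈ Icc a b, s ≤ |q t|) :
    ‖∫ t in a..b, Complex.exp (Complex.I * φ t)‖ ≤ 6 / (r * s) := by
  have hp0 : ∀ t ∈ Icc a b, p t ≠ 0 := fun t ht => abs_pos.1 (hr.trans_le (hpr t ht))
  have hq0 : ∀ t ∈ Icc a b, q t ≠ 0 := fun t ht => abs_pos.1 (hs.trans_le (hqs t ht))
  have hu := hp.inv hp0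
  have hv := hq.inv hq0
  have huB : ∀ t ∈ Icc a b, |(p t)⁻¹| ≤ r⁻¹ := fun t ht => by
    rw [abs_inv]
    exact inv_anti₀ hr (hpr t ht)
  have hvB : ∀ t ∈ Icc a b, |(q t)⁻¹| ≤ s⁻¹ := fun t ht => by
    rw [abs_inv]
    exact inv_anti₀ hs (hqs t ht)
  have hw : ∀ t ∈ Icc a b, |(p t)⁻¹ * (q t)⁻¹| ≤ r⁻¹ * s⁻¹ := fun t ht => by
    rw [abs_mul]
    exact mul_le_mul (huB t ht) (hvB t ht) (abs_nonneg _) (by positivity)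
  calc ‖∫ t in a..b, Complex.exp (Complex.I * φ t)‖
      ≤ |(p a)⁻¹ * (q a)⁻¹| + |(p b)⁻¹ * (q b)⁻¹| + ∫ t in a..b,
          |-p' t / p t ^ 2 * (q t)⁻¹ + (p t)⁻¹ * (-q' t / q t ^ 2)| := by
        refine norm_integral_cexp_le hab hφ (hp.continuousOn.mul hq.continuousOn)
          (fun t ht => (hu.hasDerivAt t ht).mul (hv.hasDerivAt t ht))
          ((hu.continuousOn_deriv.mul hv.continuousOn).add
            (hu.continuousOn.mul hv.continuousOn_deriv)) fun t ht => ?_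
        have := hp0 t ht
        have := hq0 t ht
        simp only [Pi.mul_apply]
        field_simp
    _ ≤ r⁻¹ * s⁻¹ + r⁻¹ * s⁻¹ + 4 * (r⁻¹ * s⁻¹) := by
        gcongr
        exacts [hw a (left_mem_Icc.2 hab), hw b (right_mem_Icc.2 hab),
          hu.integral_abs_deriv_mul_le hv hab huB hvB]
    _ = 6 / (r * s) := by
        rw [div_eq_mul_inv, mul_inv]
        ring

end VanDerCorput

theorem norm_setIntegral_le_of_Icc {E : Type*} [NormedAddCommGroup E] [NormedSpace ℝ E]
    {g : ℝ → E} {J : Set ℝ} {M : ℝ} (hJ : J.OrdConnected) (hb : Bornology.IsBounded J)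
    (hM : 0 ≤ M) (hg : IntegrableOn g J)
    (H : ∀ a b, a ≤ b → Icc a b ⊆ J → ‖∫ t in a..b, g t‖ ≤ M) : ‖∫ t in J, g t‖ ≤ M := by
  rcases J.eq_empty_or_nonempty with rfl | hne
  · simpa using hM
  set a := sInf J
  set b := sSup J
  have hsub : J ⊆ Icc a b := fun x hx => ⟨csInf_le hb.bddBelow hx, le_csSup hb.bddAbove hx⟩
  have hsup : Ioo a b ⊆ J := by
    rintro x ⟨hax, hxb⟩
    obtain ⟨y, hy, hyx⟩ := exists_lt_of_csInf_lt hne hax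
    obtain ⟨z, hz, hxz⟩ := exists_lt_of_lt_csSup hne hxb
    exact hJ.out hy hz ⟨hyx.le, hxz.le⟩
  have hae : J =ᵐ[volume] Ioo a b :=
    (hsub.eventuallyLE.trans_eq Ioo_ae_eq_Icc.symm).antisymm hsup.eventuallyLE
  rw [setIntegral_congr_set hae]
  rcases le_or_gt b a with hba | hab
  · simpa [hba] using hM
  obtain ⟨x, -, hx, hxa⟩ := exists_seq_strictAnti_tendsto' hab
  obtain ⟨y, -, hy, hyb⟩ := exists_seq_strictMono_tendsto' hab
  refine le_of_tendsto ((aecover_Ioo_of_Icc hxa hyb).integral_tendsto_of_countably_generated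
    (hg.mono_set hsup)).norm (Eventually.of_forall fun n => ?_)
  have hIoo : Icc (x n) (y n) ⊆ Ioo a b := Icc_subset_Ioo (hx n).1 (hy n).2
  rw [Measure.restrict_restrict measurableSet_Icc, inter_eq_self_of_subset_left hIoo]
  rcases le_or_gt (x n) (y n) with hxy | hyx
  · rw [integral_Icc_eq_integral_Ioc, ← intervalIntegral.integral_of_le hxy]
    exact H _ _ hxy (hIoo.trans hsup)
  · simpa [hyx] using hM

open Polynomial in
theorem IntervalPartition.univ_singleSigned_derivative {Q : ℝ[X]} {m : ℕ}
    (hQ : Q.natDegree ≤ m) :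
    IntervalPartition (fun J => SingleSignedOn (fun t => Q.derivative.eval t) J) (2 ^ (m + 1))
      univ := by
  have hchain : DerivChainOn (fun i t => (derivative^[i] Q).eval t) univ := fun t _ i => by
    simpa only [Function.iterate_succ_apply'] using Polynomial.hasDerivAt _ t
  have hconst : derivative^[m + 1] Q = 0 :=
    iterate_derivative_eq_zero (Nat.lt_succ_of_le hQ)
  have hpart := (interval ordConnected_univ trivial : IntervalPartition (fun _ => True) 1 univ)
    |>.singleSigned (N := m + 1) hchain fun J _ _ => by
      simp only [hconst, eval_zero]
      exact singleSignedOn_const 0 J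
  rw [one_mul] at hpart
  exact hpart.imp fun J _ _ hJ => hJ 1 (Nat.le_add_left 1 m)

section PolynomialPartition

variable {Q : Polynomial ℝ} {m : ℕ}

theorem monotoneOn_or_antitoneOn_eval {J : Set ℝ} (hJ : J.OrdConnected)
    (hs : SingleSignedOn (fun t => Q.derivative.eval t) J) :
    MonotoneOn (fun t => Q.eval t) J ∨ AntitoneOn (fun t => Q.eval t) J :=
  DerivChainOn.monotoneOn_or_antitoneOn (h := fun i t => (Polynomial.derivative^[i] Q).eval t)
    (i := 0) (fun t _ i => by
      simpa only [Function.iterate_succ_apply'] using Polynomial.hasDerivAt _ t) hJ hs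

theorem IntervalPartition.polynomial_le_abs (hQ : Q.natDegree ≤ m) {s : ℝ} (hs : 0 < s) :
    IntervalPartition (fun J => SingleSignedOn (fun t => Q.derivative.eval t) J)
      (2 ^ (m + 1) * 2) {t | s ≤ |Q.eval t|} := by
  rw [← univ_inter {t | s ≤ |Q.eval t|}]
  exact (univ_singleSigned_derivative hQ).inter_preimage (g := fun t => Q.eval t) (le_abs hs)
    (fun J _ hJ hJs => monotoneOn_or_antitoneOn_eval hJ hJs)
    fun J I hJs _ => hJs.mono inter_subset_left

theorem IntervalPartition.polynomial_abs_lt (hQ : Q.natDegree ≤ m) (s : ℝ) :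
    IntervalPartition (fun _ => True) (2 ^ (m + 1)) {t | |Q.eval t| < s} := by
  rw [← univ_inter {t | |Q.eval t| < s}, ← mul_one (2 ^ (m + 1))]
  exact (univ_singleSigned_derivative hQ).inter_preimage (g := fun t => Q.eval t) (abs_lt s)
    (fun J _ hJ hJs => monotoneOn_or_antitoneOn_eval hJ hJs)
    fun _ _ _ _ => trivial

end PolynomialPartition

theorem IntervalPartition.le_abs_inter_polynomial_le_abs {p : Set ℝ → Prop} {h : ℕ → ℝ → ℝ}
    {S : Set ℝ} {K N m : ℕ} {Q : Polynomial ℝ} {η s : ℝ} (hS : IntervalPartition p K S)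
    (hh : DerivChainOn h S) (hN : 2 ≤ N)
    (hhs : ∀ J ⊆ S, J.OrdConnected → SingleSignedOn (h N) J) (hQ : Q.natDegree ≤ m)
    (hη : 0 < η) (hs : 0 < s) :
    IntervalPartition (fun J => SingleSignedOn (h 1) J ∧ SingleSignedOn (h 2) J ∧
        SingleSignedOn (fun t => Q.derivative.eval (h 0 t)) J)
      (K * 2 ^ N * 2 * (2 ^ (m + 1) * 2))
      (S ∩ {t | η ≤ |h 1 t|} ∩ {t | s ≤ |Q.eval (h 0 t)|}) := by
  have hfar := (hS.singleSigned hh hhs).inter_preimage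
    (r := fun J => SingleSignedOn (h 1) J ∧ SingleSignedOn (h 2) J) (.le_abs hη)
    (fun J hJS hJ hJs => (hh.mono hJS).monotoneOn_or_antitoneOn hJ (hJs 2 hN))
    fun J I hJs _ => ⟨(hJs 1 (one_le_two.trans hN)).mono inter_subset_left,
      (hJs 2 hN).mono inter_subset_left⟩
  refine hfar.inter_preimage (g := h 0) (.polynomial_le_abs hQ hs)
    (fun J hJS hJ hJs => (hh.mono fun t ht => (hJS ht).1).monotoneOn_or_antitoneOn hJ hJs.1)
    fun J I hJs hI => ⟨hJs.1.mono inter_subset_left, hJs.2.mono inter_subset_left, ?_⟩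
  exact hI.imp (fun hI t ht => hI _ ht.2) fun hI t ht => hI _ ht.2

theorem norm_integral_cexp_polynomial_le {h : ℕ → ℝ → ℝ} {a b s η lam : ℝ} {P : Polynomial ℝ}
    (hab : a ≤ b) (hh : DerivChainOn h (Icc a b)) (hlam : lam ≠ 0) (hη : 0 < η) (hs : 0 < s)
    (hh1 : ∀ t ∈ Icc a b, η ≤ |h 1 t|) (hP : ∀ t ∈ Icc a b, s ≤ |P.derivative.eval (h 0 t)|)
    (hh1s : SingleSignedOn (h 1) (Icc a b)) (hh2s : SingleSignedOn (h 2) (Icc a b))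
    (hPs : SingleSignedOn (fun t => P.derivative.derivative.eval (h 0 t)) (Icc a b)) :
    ‖∫ t in a..b, Complex.exp (Complex.I * ((lam * P.eval (h 0 t) : ℝ) : ℂ))‖ ≤
      6 / (|lam| * s * η) := by
  have hcomp : ∀ R : Polynomial ℝ, ∀ t ∈ Icc a b,
      HasDerivAt (fun t => R.eval (h 0 t)) (R.derivative.eval (h 0 t) * h 1 t) t :=
    fun R t ht => (R.hasDerivAt (h 0 t)).comp t (hh t ht 0)
  refine norm_integral_cexp_le_of_deriv_eq_mul (p := fun t => lam * P.derivative.eval (h 0 t))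
    (q := h 1) hab (by positivity : 0 < |lam| * s) hη
    (fun t ht => mul_assoc lam _ _ ▸ (hcomp P t ht).const_mul lam)
    ⟨fun t ht => (hcomp P.derivative t ht).const_mul lam, ?_,
      (singleSignedOn_const lam _).mul (hPs.mul hh1s)⟩ (fun t ht => ?_)
    ⟨fun t ht => hh t ht 1, hh.continuousOn 2, hh2s⟩ hh1
  · exact continuousOn_const.mul
      ((P.derivative.derivative.continuous.comp_continuousOn (hh.continuousOn 0)).mul
        (hh.continuousOn 1))
  · rw [abs_mul]
    gcongr
    exact hP t ht

theorem exists_norm_integral_indicator_cexp_le (K m : ℕ) {N : ℕ} (hN : 2 ≤ N) : ∃ C : ℝ, 0 ≤ C ∧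
    ∀ (p : Set ℝ → Prop) (S : Set ℝ) (h : ℕ → ℝ → ℝ) (P : Polynomial ℝ) (s η lam : ℝ),
      IntervalPartition p K S → Bornology.IsBounded S → DerivChainOn h S →
      (∀ J ⊆ S, J.OrdConnected → SingleSignedOn (h N) J) →
      P.derivative.natDegree ≤ m → 0 < s → 0 < η → lam ≠ 0 →
      ‖∫ t, (S ∩ {t | η ≤ |h 1 t|} ∩ {t | s ≤ |P.derivative.eval (h 0 t)|}).indicator
        (fun t => Complex.exp (Complex.I * ((lam * P.eval (h 0 t) : ℝ) : ℂ))) t‖ ≤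
          C / (|lam| * s * η) := by
  refine ⟨(K * 2 ^ N * 2 * (2 ^ (m + 1) * 2) : ℕ) * 6, by positivity, ?_⟩
  intro p S h P s η lam hS hSb hh hhs hP hs hη hlam
  have hpart := hS.le_abs_inter_polynomial_le_abs hh hN hhs hP hη hs
  set S' := S ∩ {t | η ≤ |h 1 t|} ∩ {t | s ≤ |P.derivative.eval (h 0 t)|}
  have hS'S : S' ⊆ S := fun t ht => ht.1.1
  have hint : IntegrableOn
      (fun t => Complex.exp (Complex.I * ((lam * P.eval (h 0 t) : ℝ) : ℂ))) S' := by
    refine IntegrableOn.of_bound (hSb.subset hS'S).measure_lt_top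
      (ContinuousOn.aestronglyMeasurable ?_ hpart.measurableSet) 1
      (Eventually.of_forall fun t => (norm_cexp_I_mul_ofReal _).le)
    have := (hh.mono hS'S).continuousOn 0
    fun_prop
  rw [integral_indicator hpart.measurableSet, mul_div_assoc]
  refine hpart.norm_setIntegral_le (by positivity) hint fun J hJS' hJ ⟨hJ1, hJ2, hJP⟩ => ?_
  refine norm_setIntegral_le_of_Icc hJ (hSb.subset (hJS'.trans hS'S)) (by positivity)
    (hint.mono_set hJS') fun a b hab hsub => ?_
  exact norm_integral_cexp_polynomial_le hab (hh.mono (hsub.trans (hJS'.trans hS'S))) hlam hη hs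
    (fun t ht => (hJS' (hsub ht)).1.2) (fun t ht => (hJS' (hsub ht)).2)
    (hJ1.mono hsub) (hJ2.mono hsub) (hJP.mono hsub)

section Coefficients

open Polynomial

theorem natDegree_comp_C_mul_X_le (p : ℝ[X]) (t : ℝ) :
    (p.comp (C t * X)).natDegree ≤ p.natDegree :=
  natDegree_comp_le.trans (by
    simpa using Nat.mul_le_mul_left p.natDegree ((natDegree_C_mul_le t X).trans natDegree_X_le))

theorem exists_abs_coeff_le_of_linearMap {W : Type*} [NormedAddCommGroup W] [NormedSpace ℝ W]
    (m : ℕ) (E : ℝ[X] →ₗ[ℝ] W) (hE : ∀ p : ℝ[X], p.natDegree ≤ m → E p = 0 → p = 0) :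
    ∃ K : ℝ, 1 ≤ K ∧ ∀ p : ℝ[X], p.natDegree ≤ m → ∀ i, |p.coeff i| ≤ K * ‖E p‖ := by
  have hmem : ∀ p : ℝ[X], p ∈ degreeLT ℝ (m + 1) ↔ p.natDegree ≤ m := fun p => by
    rw [mem_degreeLT, degree_lt_iff_coeff_zero, natDegree_le_iff_coeff_eq_zero]
    simp only [Nat.succ_le_iff]
  let L : (Fin (m + 1) → ℝ) →ₗ[ℝ] W :=
    E ∘ₗ (degreeLT ℝ (m + 1)).subtype ∘ₗ (degreeLTEquiv ℝ (m + 1)).symm.toLinearMap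
  have hker : LinearMap.ker L = ⊥ := by
    rw [LinearMap.ker_eq_bot']
    intro v hv
    simpa using hE _ ((hmem _).1 ((degreeLTEquiv ℝ (m + 1)).symm v).2) hv
  obtain ⟨K, -, hL⟩ := L.exists_antilipschitzWith hker
  refine ⟨max K 1, le_max_right _ _, fun p hp i => ?_⟩
  rcases le_or_gt i m with hi | hi
  · set v := degreeLTEquiv ℝ (m + 1) ⟨p, (hmem p).2 hp⟩ with hv
    have hLv : L v = E p := by simp [L, hv]
    calc |p.coeff i| = ‖v ⟨i, Nat.lt_succ_of_le hi⟩‖ := by simp [hv, degreeLTEquiv]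
      _ ≤ ‖v‖ := norm_le_pi_norm v _
      _ ≤ K * ‖E p‖ := by simpa [hLv] using hL.le_mul_dist v 0
      _ ≤ max K 1 * ‖E p‖ := by
        gcongr
        exact le_max_left _ _
  · rw [coeff_eq_zero_of_natDegree_lt (hp.trans_lt hi), abs_zero]
    positivity

theorem exists_abs_coeff_le_of_abs_eval_le (m : ℕ) : ∃ K : ℝ, 1 ≤ K ∧ ∀ (p : ℝ[X]) (s : ℝ),
    p.natDegree ≤ m → (∀ t ∈ Icc (0 : ℝ) 1, |p.eval t| ≤ s) → ∀ i, |p.coeff i| ≤ K * s := by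
  have hinj : Function.Injective fun i : Fin (m + 1) => ((i : ℝ) / (m + 1)) := by
    intro i j hij
    have : (m : ℝ) + 1 ≠ 0 := by positivity
    simpa [div_left_inj' this, Fin.ext_iff] using hij
  obtain ⟨K, hK, H⟩ := exists_abs_coeff_le_of_linearMap m
    (LinearMap.pi fun i : Fin (m + 1) => leval ((i : ℝ) / (m + 1))) fun p hp h0 =>
      eq_zero_of_natDegree_lt_card_of_eval_eq_zero p hinj (fun i => congrFun h0 i)
        (by simpa [Nat.lt_succ_iff] using hp)
  refine ⟨K, hK, fun p s hp hs i => (H p hp i).trans ?_⟩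
  gcongr
  refine (pi_norm_le_iff_of_nonneg ((abs_nonneg _).trans (hs 0 (by simp)))).2 fun i => ?_
  refine hs _ ⟨by positivity, ?_⟩
  rw [div_le_one (by positivity)]
  exact_mod_cast i.2.le

theorem eq_zero_of_X_pow_dvd_of_X_sub_one_pow_dvd {p : ℝ[X]} {m r q : ℕ} (hp : p.natDegree ≤ m)
    (hrq : m < r + q) (hr : X ^ r ∣ p) (hq : (X - C 1) ^ q ∣ p) : p = 0 := by
  have hcop : IsCoprime (X ^ r : ℝ[X]) ((X - C 1) ^ q) := IsCoprime.pow ⟨1, -1, by simp⟩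
  by_contra hp0
  have hdeg := natDegree_le_of_dvd (hcop.mul_dvd hr hq) hp0
  rw [(monic_X_pow r).natDegree_mul ((monic_X_sub_C 1).pow q), natDegree_X_pow, natDegree_pow,
    natDegree_X_sub_C] at hdeg
  lia

theorem exists_abs_coeff_le_of_hermite {m r q : ℕ} (hrq : m < r + q) : ∃ K : ℝ, 1 ≤ K ∧
    ∀ (p : ℝ[X]) (s : ℝ), p.natDegree ≤ m → 0 ≤ s → (∀ i < r, |p.coeff i| ≤ s) →
      (∀ i < q, |(taylor 1 p).coeff i| ≤ s) → ∀ i, |p.coeff i| ≤ K * s := by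
  obtain ⟨K, hK, H⟩ := exists_abs_coeff_le_of_linearMap m
    ((LinearMap.pi fun i : Fin r => lcoeff ℝ (i : ℕ)).prod
      (LinearMap.pi fun i : Fin q => lcoeff ℝ (i : ℕ) ∘ₗ taylor 1)) fun p hp h0 => by
      obtain ⟨hr, hq⟩ := Prod.mk_eq_zero.1 h0
      refine eq_zero_of_X_pow_dvd_of_X_sub_one_pow_dvd hp hrq
        (X_pow_dvd_iff.2 fun i hi => congrFun hr ⟨i, hi⟩) ?_
      rw [X_sub_C_pow_dvd_iff, ← taylor_apply]
      exact X_pow_dvd_iff.2 fun i hi => congrFun hq ⟨i, hi⟩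
  refine ⟨K, hK, fun p s hp hs hr hq i => (H p hp i).trans ?_⟩
  gcongr
  exact norm_prod_le_iff.2 ⟨(pi_norm_le_iff_of_nonneg hs).2 fun i => hr i i.2,
    (pi_norm_le_iff_of_nonneg hs).2 fun i => hq i i.2⟩

-- Far from the origin, rescale to `Q (t x) / t ^ k`: its coefficients below the `k`-th are at most
-- `1 / |t|`, so Hermite data at `0` and `1` would be too small if the Taylor data at `t` were.
theorem exists_one_le_mul_of_abs_taylor_coeff_le_of_large {m k : ℕ} (hk : m ≤ 2 * k) :
    ∃ K : ℝ, 1 ≤ K ∧ ∀ (Q : ℝ[X]) (t s : ℝ), Q.natDegree ≤ m → (∀ i, |Q.coeff i| ≤ 1) →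
      |Q.coeff k| = 1 → K < |t| → (∀ i, |(taylor t Q).coeff i| ≤ s) → 1 ≤ K * s := by
  obtain ⟨K, hK, H⟩ := exists_abs_coeff_le_of_hermite (m := m) (r := k) (q := k + 1) (by lia)
  refine ⟨K, hK, fun Q t s hQ hle hone ht hs => ?_⟩
  have ht1 : 1 ≤ |t| := hK.trans ht.le
  have ht0 : 0 < |t| := one_pos.trans_le ht1
  set p := Q.comp (C t * X) with hp
  have hcoeff : ∀ i, |p.coeff i| = |Q.coeff i| * |t| ^ i := fun i => by
    rw [hp, comp_C_mul_X_coeff, abs_mul, abs_pow]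
  have htaylor : taylor 1 p = (taylor t Q).comp (C t * X) := by
    simp [hp, taylor_apply, comp_assoc, mul_add]
  have hbound : |p.coeff k| ≤ K * (|t| ^ k * max |t|⁻¹ s) := by
    refine H p _ ((natDegree_comp_C_mul_X_le Q t).trans hQ) (by positivity) (fun i hi => ?_)
      (fun i hi => ?_) k
    · calc |p.coeff i| ≤ 1 * |t| ^ (k - 1) := by
            rw [hcoeff]
            gcongr
            exacts [hle i, by lia]
        _ = |t| ^ k * |t|⁻¹ := by
            rw [one_mul, eq_mul_inv_iff_mul_eq₀ ht0.ne', pow_sub_one_mul (by lia)]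
        _ ≤ |t| ^ k * max |t|⁻¹ s := by
            gcongr
            exact le_max_left _ _
    · rw [htaylor, comp_C_mul_X_coeff, abs_mul, abs_pow, mul_comm]
      gcongr
      exacts [by lia, (hs i).trans (le_max_right _ _)]
  rw [hcoeff, hone, one_mul, mul_left_comm] at hbound
  have hmax : 1 ≤ K * max |t|⁻¹ s :=
    le_of_mul_le_mul_left (by rwa [mul_one]) (pow_pos ht0 k)
  rcases le_total s |t|⁻¹ with h | h
  · rw [max_eq_left h, ← div_eq_mul_inv, one_le_div ht0] at hmax
    exact absurd hmax (not_le.2 ht)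
  · rwa [max_eq_right h] at hmax

theorem exists_abs_coeff_le_of_abs_taylor_coeff_le (m : ℕ) {R : ℝ} (hR : 0 ≤ R) :
    ∃ K : ℝ, 1 ≤ K ∧ ∀ (Q : ℝ[X]) (t s : ℝ), Q.natDegree ≤ m → |t| ≤ R →
      (∀ i, |(taylor t Q).coeff i| ≤ s) → ∀ i, |Q.coeff i| ≤ K * s := by
  obtain ⟨K, hK, H⟩ := exists_abs_coeff_le_of_abs_eval_le m
  refine ⟨K * ((m + 1) * (1 + R) ^ m), ?_, fun Q t s hQ ht hs i => ?_⟩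
  · exact one_le_mul_of_one_le_of_one_le hK (one_le_mul_of_one_le_of_one_le (by simp)
      (one_le_pow₀ (by simpa using hR)))
  rw [mul_assoc]
  refine H Q _ hQ (fun x hx => ?_) i
  have hxt : |x - t| ≤ 1 + R := by
    refine (abs_sub _ _).trans (add_le_add ?_ ht)
    rw [abs_of_nonneg hx.1]
    exact hx.2
  have hs0 : 0 ≤ s := (abs_nonneg _).trans (hs 0)
  calc |Q.eval x| = |(taylor t Q).eval (x - t)| := by simp [taylor_eval]
    _ = |∑ i ∈ Finset.range (m + 1), (taylor t Q).coeff i * (x - t) ^ i| := by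
        rw [eval_eq_sum_range' (n := m + 1) (by rwa [natDegree_taylor, Nat.lt_succ_iff])]
    _ ≤ ∑ i ∈ Finset.range (m + 1), |(taylor t Q).coeff i * (x - t) ^ i| :=
        Finset.abs_sum_le_sum_abs _ _
    _ ≤ ∑ _i ∈ Finset.range (m + 1), s * (1 + R) ^ m := by
        refine Finset.sum_le_sum fun i hi => ?_
        rw [abs_mul, abs_pow]
        gcongr
        · exact hs i
        · exact (pow_le_pow_left₀ (abs_nonneg _) hxt i).trans
            (pow_le_pow_right₀ (by linarith) (Finset.mem_range_succ_iff.1 hi))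
    _ = (m + 1) * (1 + R) ^ m * s := by
        simp
        ring

theorem exists_one_le_mul_of_abs_taylor_coeff_le (m : ℕ) : ∃ K : ℝ, 1 ≤ K ∧
    ∀ (Q : ℝ[X]) (t s : ℝ), Q.natDegree = m → (Q.Monic ∨ IsSND Q) →
      (∀ i, |(taylor t Q).coeff i| ≤ s) → 1 ≤ K * s := by
  have hfixed : ∀ k : ℕ, ∃ K : ℝ, 0 ≤ K ∧ (m ≤ 2 * k → ∀ (Q : ℝ[X]) (t s : ℝ),
      Q.natDegree ≤ m → (∀ i, |Q.coeff i| ≤ 1) → |Q.coeff k| = 1 →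
      (∀ i, |(taylor t Q).coeff i| ≤ s) → 1 ≤ K * s) := fun k => by
    by_cases hk : m ≤ 2 * k
    · obtain ⟨K₁, hK₁, H₁⟩ := exists_one_le_mul_of_abs_taylor_coeff_le_of_large hk
      obtain ⟨K₂, -, H₂⟩ := exists_abs_coeff_le_of_abs_taylor_coeff_le m
        (zero_le_one.trans hK₁)
      refine ⟨max K₁ K₂, by positivity, fun _ Q t s hQ hle hone hs => ?_⟩
      have hs0 : 0 ≤ s := (abs_nonneg _).trans (hs 0)
      rcases lt_or_ge K₁ |t| with ht | ht
      · exact (H₁ Q t s hQ hle hone ht hs).trans (by gcongr; exact le_max_left _ _)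
      · exact (hone.ge.trans (H₂ Q t s hQ ht hs k)).trans (by gcongr; exact le_max_right _ _)
    · exact ⟨0, le_rfl, fun h => absurd h hk⟩
  choose K hK0 hK using hfixed
  have hsum := Finset.sum_nonneg fun k (_ : k ∈ Finset.range (m + 1)) => hK0 k
  refine ⟨1 + ∑ k ∈ Finset.range (m + 1), K k, by linarith, fun Q t s hQ hQ' hs => ?_⟩
  have hs0 : 0 ≤ s := (abs_nonneg _).trans (hs 0)
  rcases hQ' with hmonic | ⟨hle, j, hj, hone⟩
  · have htop : 1 ≤ s := by
      simpa [← coeff_natDegree, hmonic.coeff_natDegree, coeff_taylor_natDegree, hmonic.leadingCoeff]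
        using hs Q.natDegree
    nlinarith
  · have hterm := hK (Q.natDegree - j) (by lia) Q t s hQ.le hle hone hs
    refine hterm.trans (mul_le_mul_of_nonneg_right ?_ hs0)
    have := Finset.single_le_sum (fun k _ => hK0 k)
      (Finset.mem_range_succ_iff.2 (hQ ▸ Nat.sub_le _ _) : Q.natDegree - j ∈ Finset.range (m + 1))
    linarith

theorem exists_pow_le_mul_abs_eval (m : ℕ) : ∃ K : ℝ, 1 ≤ K ∧ ∀ Q : ℝ[X], Q.natDegree = m →
    (Q.Monic ∨ IsSND Q) → ∀ ε : ℝ, 0 < ε → ε ≤ 1 → ∀ a : ℝ,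
      ∃ t ∈ Icc a (a + ε), ε ^ m ≤ K * |Q.eval t| := by
  obtain ⟨K₁, hK₁, H₁⟩ := exists_one_le_mul_of_abs_taylor_coeff_le m
  obtain ⟨K₂, hK₂, H₂⟩ := exists_abs_coeff_le_of_abs_eval_le m
  refine ⟨K₁ * K₂, one_le_mul_of_one_le_of_one_le hK₁ hK₂, fun Q hQ hQ' ε hε hε1 a => ?_⟩
  obtain ⟨x, hx, hmax⟩ := isCompact_Icc.exists_isMaxOn
    (nonempty_Icc.2 (by linarith : a ≤ a + ε)) Q.continuous.abs.continuousOn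
  refine ⟨x, hx, ?_⟩
  have hscaled : ∀ i, |((taylor a Q).comp (C ε * X)).coeff i| ≤ K₂ * |Q.eval x| := by
    refine H₂ _ _ ((natDegree_comp_C_mul_X_le _ _).trans (by rw [natDegree_taylor, hQ]))
      fun y hy => ?_
    have heval : ((taylor a Q).comp (C ε * X)).eval y = Q.eval (a + ε * y) := by
      simp [taylor_eval, add_comm]
    rw [heval]
    exact hmax ⟨by nlinarith [hy.1], by nlinarith [hy.2]⟩
  have htaylor : ∀ i, |(taylor a Q).coeff i| ≤ K₂ * |Q.eval x| / ε ^ m := fun i => by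
    rcases le_or_gt i m with hi | hi
    · rw [le_div_iff₀ (by positivity)]
      refine le_trans ?_ (hscaled i)
      rw [comp_C_mul_X_coeff, abs_mul, abs_of_pos (pow_pos hε i)]
      exact mul_le_mul_of_nonneg_left (pow_le_pow_of_le_one hε.le hε1 hi) (abs_nonneg _)
    · rw [coeff_eq_zero_of_natDegree_lt (by rwa [natDegree_taylor, hQ]), abs_zero]
      positivity
  have := H₁ Q a _ hQ hQ' htaylor
  rwa [← mul_div_assoc, one_le_div (by positivity), ← mul_assoc] at this

end Coefficients

section MixedDerivatives

variable {n : ℕ} {U : Set (EuclideanSpace ℝ (Fin n))} {f : EuclideanSpace ℝ (Fin n) → ℝ}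

theorem contDiffOn_pderiv (hU : IsOpen U) (hf : ContDiffOn ℝ ∞ f U) (j : Fin n) :
    ContDiffOn ℝ ∞ (pderiv j f) U :=
  (hf.fderiv_of_isOpen hU (m := ∞) (by simp)).clm_apply contDiffOn_const

theorem contDiffOn_iterate_pderiv (hU : IsOpen U) (hf : ContDiffOn ℝ ∞ f U) (j : Fin n) (i : ℕ) :
    ContDiffOn ℝ ∞ ((pderiv j)^[i] f) U := by
  induction i with
  | zero => exact hf
  | succ i ih =>
    rw [Function.iterate_succ_apply']
    exact contDiffOn_pderiv hU ih j

theorem foldr_iterate_pderiv_of_forall_eq_zero {β : Fin n → ℕ} {l : List (Fin n)}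
    (hβ : ∀ i ∈ l, β i = 0) : l.foldr (fun j g => (pderiv j)^[β j] g) f = f := by
  induction l with
  | nil => rfl
  | cons a l ih =>
    rw [List.foldr_cons, hβ a List.mem_cons_self, Function.iterate_zero, id,
      ih fun i hi => hβ i (List.mem_cons_of_mem a hi)]

theorem mderiv_zero (f : EuclideanSpace ℝ (Fin n) → ℝ) : mderiv 0 f = f :=
  foldr_iterate_pderiv_of_forall_eq_zero fun _ _ => rfl

theorem mderiv_add_single {γ : Fin n → ℕ} {k : Fin n} (hγ : ∀ i, k < i → γ i = 0) (m : ℕ)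
    (f : EuclideanSpace ℝ (Fin n) → ℝ) :
    mderiv (γ + Pi.single k m) f = mderiv γ ((pderiv k)^[m] f) := by
  obtain ⟨l₁, l₂, hl⟩ := List.append_of_mem (List.mem_finRange k)
  have hlt := List.pairwise_lt_finRange n
  rw [hl, List.pairwise_append, List.pairwise_cons] at hlt
  obtain ⟨-, ⟨hl₂, -⟩, hl₁⟩ := hlt
  have hγ₂ : ∀ i ∈ l₂, γ i = 0 := fun i hi => hγ i (hl₂ i hi)
  have hβ₂ : ∀ i ∈ l₂, (γ + Pi.single k m : Fin n → ℕ) i = 0 := fun i hi => by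
    rw [Pi.add_apply, hγ₂ i hi, Pi.single_eq_of_ne (hl₂ i hi).ne', add_zero]
  simp only [mderiv, hl, List.foldr_append, List.foldr_cons]
  rw [foldr_iterate_pderiv_of_forall_eq_zero hγ₂,
    foldr_iterate_pderiv_of_forall_eq_zero hβ₂,
    Pi.add_apply, Pi.single_eq_same, Function.iterate_add_apply]
  refine List.foldr_ext _ _ _ fun i hi g => ?_
  rw [Pi.add_apply, Pi.single_eq_of_ne (hl₁ i hi k List.mem_cons_self).ne, add_zero]

theorem mderiv_single (k : Fin n) (m : ℕ) (f : EuclideanSpace ℝ (Fin n) → ℝ) :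
    mderiv (Pi.single k m) f = (pderiv k)^[m] f := by
  simpa only [zero_add, mderiv_zero] using mderiv_add_single (γ := 0) (fun _ _ => rfl) m f

theorem multiIndex_induction {p : (Fin n → ℕ) → Prop} (β : Fin n → ℕ) (zero : p 0)
    (add_single : ∀ (γ : Fin n → ℕ) (k : Fin n) (m : ℕ), m ≠ 0 → (∀ i, k ≤ i → γ i = 0) → p γ →
      p (γ + Pi.single k m)) : p β := by
  refine Finsupp.induction_on_max (motive := fun g : Fin n →₀ ℕ => p g)
    (Finsupp.equivFunOnFinite.symm β) zero fun k m γ hγ hm ih => ?_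
  rw [add_comm, Finsupp.coe_add, Finsupp.single_eq_pi_single]
  refine add_single γ k m hm (fun i hki => ?_) ih
  by_contra hi
  exact (hγ i (Finsupp.mem_support_iff.2 hi)).not_ge hki

theorem exists_eq_add_single {β : Fin n → ℕ} (hβ : β ≠ 0) : ∃ (γ : Fin n → ℕ) (k : Fin n) (m : ℕ),
    m ≠ 0 ∧ (∀ i, k ≤ i → γ i = 0) ∧ β = γ + Pi.single k m :=
  multiIndex_induction (p := fun β => β ≠ 0 → ∃ (γ : Fin n → ℕ) (k : Fin n) (m : ℕ),
    m ≠ 0 ∧ (∀ i, k ≤ i → γ i = 0) ∧ β = γ + Pi.single k m) β (fun h => absurd rfl h)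
    (fun γ k m hm hγ _ _ => ⟨γ, k, m, hm, hγ, rfl⟩) hβ

theorem pderiv_sub_const (j : Fin n) (f : EuclideanSpace ℝ (Fin n) → ℝ) (c : ℝ) :
    pderiv j (fun x => f x - c) = pderiv j f := by
  ext x
  simp only [pderiv, fderiv_sub_const]

theorem mderiv_sub_const {β : Fin n → ℕ} (hβ : β ≠ 0) (f : EuclideanSpace ℝ (Fin n) → ℝ) (c : ℝ) :
    mderiv β (fun x => f x - c) = mderiv β f := by
  obtain ⟨γ, k, m, hm, hγ, rfl⟩ := exists_eq_add_single hβ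
  obtain ⟨m, rfl⟩ := Nat.exists_eq_succ_of_ne_zero hm
  have hγ' : ∀ i, k < i → γ i = 0 := fun i hi => hγ i hi.le
  simp only [mderiv_add_single hγ', Function.iterate_succ_apply, pderiv_sub_const]

theorem tailIndex_add_single {γ N N' : Fin n → ℕ} {j k : Fin n} {m : ℕ} (hjk : j ≤ k)
    (hN : N j = N' j + (Pi.single k m : Fin n → ℕ) j) :
    tailIndex (γ + Pi.single k m) N j = tailIndex γ N' j + Pi.single k m := by
  ext i
  simp only [tailIndex, Pi.add_apply]
  split_ifs with hij hij'
  · rw [Pi.single_eq_of_ne (hij.trans_le hjk).ne, add_zero]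
  · rw [hij', hN]
  · rfl

theorem tailIndex_eq_single {β : Fin n → ℕ} {k : Fin n} (hβ : ∀ i, k < i → β i = 0)
    (N : Fin n → ℕ) : tailIndex β N k = Pi.single k (N k) := by
  ext i
  rcases lt_trichotomy i k with hi | rfl | hi
  · simp [tailIndex, hi, hi.ne]
  · simp [tailIndex]
  · simp [tailIndex, hi.not_gt, hi.ne', hβ i hi]

theorem mderiv_tailIndex {β : Fin n → ℕ} {k : Fin n} (hβ : ∀ i, k < i → β i = 0)
    (N : Fin n → ℕ) (f : EuclideanSpace ℝ (Fin n) → ℝ) :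
    mderiv (tailIndex β N k) f = (pderiv k)^[N k] f := by
  rw [tailIndex_eq_single hβ, mderiv_single]

/-- The line through `x` parallel to the `j`-th coordinate axis, parametrised by that
coordinate. -/
def axisLine (x : Fin n → ℝ) (j : Fin n) (t : ℝ) : EuclideanSpace ℝ (Fin n) :=
  WithLp.toLp 2 (Function.update x j t)

theorem hasDerivAt_axisLine (x : Fin n → ℝ) (j : Fin n) (t : ℝ) :
    HasDerivAt (axisLine x j) (EuclideanSpace.single j 1) t :=
  (EuclideanSpace.equiv (Fin n) ℝ).symm.hasFDerivAt.comp_hasDerivAt t (hasDerivAt_update x j t)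

theorem derivChainOn_axisLine {X : Set (EuclideanSpace ℝ (Fin n))} (hU : IsOpen U) (hX : X ⊆ U)
    (hf : ContDiffOn ℝ ∞ f U) (j : Fin n) (x : Fin n → ℝ) :
    DerivChainOn (fun i t => (pderiv j)^[i] f (axisLine x j t)) (axisLine x j ⁻¹' X) := by
  intro t ht i
  simp only [Function.iterate_succ_apply']
  have hdiff : DifferentiableAt ℝ ((pderiv j)^[i] f) (axisLine x j t) :=
    ((contDiffOn_iterate_pderiv hU hf j i).contDiffAt (hU.mem_nhds (hX ht))).differentiableAt
      (by simp)
  exact hdiff.hasFDerivAt.comp_hasDerivAt t (hasDerivAt_axisLine x j t)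

end MixedDerivatives

section Cube

variable {n : ℕ} {x₀ : Fin n → ℝ} {D : ℝ}

/-- The closed cube of centre `x₀` and side `2 D`, that is, the closed ball of radius `D` for the
sup norm, as a subset of Euclidean space. -/
def cube (x₀ : Fin n → ℝ) (D : ℝ) : Set (EuclideanSpace ℝ (Fin n)) :=
  WithLp.ofLp ⁻¹' Metric.closedBall x₀ D

theorem subset_cube_diam {X : Set (EuclideanSpace ℝ (Fin n))} (hX : Bornology.IsBounded X)
    {x : EuclideanSpace ℝ (Fin n)} (hx : x ∈ X) : X ⊆ cube x (Metric.diam X) := fun y hy => by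
  refine (dist_pi_le_iff Metric.diam_nonneg).2 fun i => ?_
  calc dist (y i) (x i) = ‖(y - x) i‖ := dist_eq_norm _ _
    _ ≤ ‖y - x‖ := PiLp.norm_apply_le _ i
    _ = dist y x := (dist_eq_norm y x).symm
    _ ≤ Metric.diam X := Metric.dist_le_diam_of_mem hX hy hx

theorem volume_cube (x₀ : Fin n → ℝ) (hD : 0 ≤ D) :
    volume (cube x₀ D) = ENNReal.ofReal ((2 * D) ^ n) := by
  rw [cube, (PiLp.volume_preserving_ofLp (Fin n)).measure_preimage
    Metric.isClosed_closedBall.nullMeasurableSet, Real.volume_pi_closedBall x₀ hD,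
    Fintype.card_fin]

theorem isBounded_axisLine_preimage_cube (x₀ x : Fin n → ℝ) (D : ℝ) (j : Fin n) :
    Bornology.IsBounded (axisLine x j ⁻¹' cube x₀ D) := by
  refine (Metric.isBounded_closedBall (x := x₀ j) (r := D)).subset fun t ht => ?_
  have hle : dist (Function.update x j t) x₀ ≤ D := ht
  simpa using (dist_le_pi_dist (Function.update x j t) x₀ j).trans hle

theorem integral_eq_integral_integral_axisLine {E : Type*} [NormedAddCommGroup E]
    [NormedSpace ℝ E] (j : Fin (n + 1)) {G : EuclideanSpace ℝ (Fin (n + 1)) → E}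
    (hG : Integrable G) :
    ∫ x, G x = ∫ y : Fin n → ℝ, ∫ t, G (axisLine (j.insertNth 0 y) j t) := by
  let φ := (MeasurableEquiv.piFinSuccAbove (fun _ => ℝ) j).symm.trans
    (MeasurableEquiv.toLp 2 (Fin (n + 1) → ℝ))
  have hφ : MeasurePreserving φ (volume.prod volume) volume :=
    (EuclideanSpace.volume_preserving_symm_measurableEquiv_toLp (Fin (n + 1))).symm.comp
      (volume_preserving_piFinSuccAbove (fun _ => ℝ) j).symm
  have hφ_apply : ∀ t y, φ (t, y) = axisLine (j.insertNth 0 y) j t := fun t y => by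
    rw [axisLine, Fin.update_insertNth]
    rfl
  rw [← hφ.integral_comp φ.measurableEmbedding, integral_prod_symm (fun z => G (φ z))
    ((hφ.integrable_comp_emb φ.measurableEmbedding).2 hG)]
  simp only [hφ_apply]

theorem norm_integral_le_of_axisLine {E : Type*} [NormedAddCommGroup E] [NormedSpace ℝ E]
    (j : Fin n) {G : EuclideanSpace ℝ (Fin n) → E} {M : ℝ} (hD : 0 ≤ D)
    (hsupp : Function.support G ⊆ cube x₀ D)
    (hM : ∀ x : Fin n → ℝ, ‖∫ t, G (axisLine x j t)‖ ≤ M) :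
    ‖∫ x, G x‖ ≤ M * (2 * D) ^ (n - 1) := by
  have hM0 : 0 ≤ M := (norm_nonneg _).trans (hM 0)
  by_cases hG : Integrable G
  swap
  · rw [integral_undef hG, norm_zero]
    positivity
  obtain ⟨n, rfl⟩ : ∃ m, n = m + 1 := ⟨n - 1, (Nat.sub_add_cancel j.pos).symm⟩
  set B := Metric.closedBall (fun i => x₀ (j.succAbove i)) D
  have hB : ∀ y ∉ B, ∫ t, G (axisLine (j.insertNth 0 y) j t) = 0 := by
    refine fun y hy => integral_eq_zero_of_ae (.of_forall fun t => ?_)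
    contrapose! hy
    have hmem : dist (Function.update (j.insertNth 0 y : Fin (n + 1) → ℝ) j t) x₀ ≤ D := hsupp hy
    refine (dist_pi_le_iff hD).2 fun i => ?_
    simpa using (dist_le_pi_dist _ _ (j.succAbove i)).trans hmem
  have hvolB : volume B = ENNReal.ofReal ((2 * D) ^ n) := by
    rw [Real.volume_pi_closedBall _ hD, Fintype.card_fin]
  rw [integral_eq_integral_integral_axisLine j hG,
    ← setIntegral_eq_integral_of_forall_compl_eq_zero hB]
  calc ‖∫ y in B, ∫ t, G (axisLine (j.insertNth 0 y) j t)‖ ≤ M * volume.real B :=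
        norm_setIntegral_le_of_norm_le_const (hvolB ▸ ENNReal.ofReal_lt_top) fun y _ => hM _
    _ = M * (2 * D) ^ n := by
        rw [measureReal_def, hvolB, ENNReal.toReal_ofReal (by positivity)]

theorem volume_le_of_axisLine (j : Fin n) {S : Set (EuclideanSpace ℝ (Fin n))}
    (hS : NullMeasurableSet S) {M : ℝ} (hD : 0 ≤ D) (hM0 : 0 ≤ M) (hsub : S ⊆ cube x₀ D)
    (hM : ∀ x, volume (axisLine x j ⁻¹' S) ≤ ENNReal.ofReal M) :
    volume S ≤ ENNReal.ofReal (M * (2 * D) ^ (n - 1)) := by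
  have hfin : volume S ≠ ⊤ :=
    ((measure_mono hsub).trans_lt (volume_cube x₀ hD ▸ ENNReal.ofReal_lt_top)).ne
  have hline : ∀ x, ‖∫ t, S.indicator (1 : EuclideanSpace ℝ (Fin n) → ℝ) (axisLine x j t)‖ ≤ M :=
    fun x => by
      refine (norm_integral_le_lintegral_norm _).trans
        (ENNReal.toReal_le_of_le_ofReal hM0 ((lintegral_mono fun t => ?_).trans
          ((lintegral_indicator_one_le (axisLine x j ⁻¹' S)).trans (hM x))))
      by_cases ht : axisLine x j t ∈ S <;> simp [indicator, ht]
  have hle := norm_integral_le_of_axisLine j hD (support_indicator_subset.trans hsub) hline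
  rw [integral_indicator₀ hS] at hle
  rw [← ENNReal.ofReal_toReal hfin]
  exact ENNReal.ofReal_le_ofReal ((le_abs_self _).trans (by simpa [measureReal_def] using hle))

end Cube

section Sublevel

theorem nullMeasurableSet_inter_preimage {α γ : Type*} [TopologicalSpace α] [MeasurableSpace α]
    [OpensMeasurableSpace α] [TopologicalSpace γ] [MeasurableSpace γ] [BorelSpace γ]
    {μ : Measure α} {X U : Set α} {F : α → γ} {B : Set γ} (hX : NullMeasurableSet X μ)
    (hU : IsOpen U) (hXU : X ⊆ U) (hF : ContinuousOn F U) (hB : MeasurableSet B) :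
    NullMeasurableSet (X ∩ F ⁻¹' B) μ := by
  have hF' : AEMeasurable F (μ.restrict X) :=
    (hF.aemeasurable hU.measurableSet).mono_measure (Measure.restrict_mono hXU le_rfl)
  rw [inter_comm]
  exact (nullMeasurableSet_restrict hX).1 (hF'.nullMeasurableSet_preimage hB)

theorem SingleSignedOn.preimage {E F : Type*} {g : F → ℝ} {X : Set F} (hg : SingleSignedOn g X)
    (φ : E → F) : SingleSignedOn (fun t => g (φ t)) (φ ⁻¹' X) :=
  hg.imp (fun h _ ht => h _ ht) (fun h _ ht => h _ ht)

/-- The index `j` belongs to the support of `β` without being its first element. These are the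
coordinates in which the induction on `β` meets a lower bound for a derivative on part of the
domain only, so that a single-signed higher derivative is required. -/
def IsSignIndex {n : ℕ} (β : Fin n → ℕ) (j : Fin n) : Prop :=
  β j ≠ 0 ∧ ∃ i < j, β i ≠ 0

/-- A phase function `f` on a domain `X` contained in the cube of centre `x₀` and side `2 D`, to
which the estimates for the multi-index `β` apply; the integers `N j` are the orders of the
single-signed derivatives. The point `x₀` need not belong to `X`. -/
structure IsAdmissible {n : ℕ} (A : ℕ) (β N : Fin n → ℕ) (x₀ : Fin n → ℝ) (D : ℝ)
    (X U : Set (EuclideanSpace ℝ (Fin n))) (f : EuclideanSpace ℝ (Fin n) → ℝ) : Prop where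
  nullMeasurableSet : NullMeasurableSet X
  nonneg : 0 ≤ D
  subset_cube : X ⊆ cube x₀ D
  slicesIn : ∀ j, β j ≠ 0 → SlicesIn j A X
  isOpen : IsOpen U
  subset : X ⊆ U
  contDiffOn : ContDiffOn ℝ ∞ f U
  one_le_abs_mderiv : ∀ x ∈ X, 1 ≤ |mderiv β f x|
  singleSignedOn : ∀ j, IsSignIndex β j → SingleSignedOn (mderiv (tailIndex β N j) f) X

variable {n A : ℕ} {β γ N N' : Fin n → ℕ} {k : Fin n} {m : ℕ} {x₀ : Fin n → ℝ} {D : ℝ}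
  {X U : Set (EuclideanSpace ℝ (Fin n))} {f : EuclideanSpace ℝ (Fin n) → ℝ}

theorem IsSignIndex.mono {j : Fin n} (hj : IsSignIndex γ j) (hle : γ ≤ β) : IsSignIndex β j := by
  obtain ⟨hj, i, hij, hi⟩ := hj
  have hpos : ∀ l, γ l ≠ 0 → β l ≠ 0 := fun l hl h => hl (Nat.le_zero.1 (h ▸ hle l))
  exact ⟨hpos j hj, i, hij, hpos i hi⟩

theorem isSignIndex_add_single (hγ : ∀ i, k ≤ i → γ i = 0) (hγ0 : γ ≠ 0) (hm : m ≠ 0) :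
    IsSignIndex (γ + Pi.single k m) k := by
  obtain ⟨i, hi⟩ := Function.ne_iff.1 hγ0
  have hik : i < k := lt_of_not_ge fun h => hi (hγ i h)
  exact ⟨by simp [hm], i, hik, by simpa [hik.ne] using hi⟩

theorem sum_add_single (γ : Fin n → ℕ) (k : Fin n) (m : ℕ) :
    ∑ i, (γ + Pi.single k m : Fin n → ℕ) i = ∑ i, γ i + m := by
  simp [Finset.sum_add_distrib]

theorem IsAdmissible.iterate_pderiv (hf : IsAdmissible A (γ + Pi.single k m) N x₀ D X U f)
    (hγ : ∀ i, k < i → γ i = 0)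
    (hN : ∀ j, IsSignIndex γ j → N j = N' j + (Pi.single k m : Fin n → ℕ) j) :
    IsAdmissible A γ N' x₀ D X U ((pderiv k)^[m] f) where
  nullMeasurableSet := hf.nullMeasurableSet
  nonneg := hf.nonneg
  subset_cube := hf.subset_cube
  slicesIn j hj := hf.slicesIn j fun h => hj (Nat.add_eq_zero_iff.1 h).1
  isOpen := hf.isOpen
  subset := hf.subset
  contDiffOn := contDiffOn_iterate_pderiv hf.isOpen hf.contDiffOn k m
  one_le_abs_mderiv x hx := by
    rw [← mderiv_add_single hγ]
    exact hf.one_le_abs_mderiv x hx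
  singleSignedOn j hj := by
    have hjk : j ≤ k := le_of_not_gt fun h => hj.1 (hγ j h)
    have htail : ∀ i, k < i → tailIndex γ N' j i = 0 := fun i hi => by
      have hji : j < i := hjk.trans_lt hi
      rw [tailIndex, if_neg hji.not_gt, if_neg hji.ne', hγ i hi]
    rw [← mderiv_add_single htail, ← tailIndex_add_single hjk (hN j hj)]
    exact hf.singleSignedOn j (hj.mono le_self_add)

theorem IsAdmissible.sub_const (hf : IsAdmissible A β N x₀ D X U f) (hβ : β ≠ 0)
    (hN : ∀ j, IsSignIndex β j → β j < N j) (c : ℝ) :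
    IsAdmissible A β N x₀ D X U (fun x => f x - c) where
  __ := hf
  contDiffOn := hf.contDiffOn.sub contDiffOn_const
  one_le_abs_mderiv := by simpa only [mderiv_sub_const hβ] using hf.one_le_abs_mderiv
  singleSignedOn j hj := by
    have htail : tailIndex β N j ≠ 0 := Function.ne_iff.2
      ⟨j, by simpa [tailIndex] using (hN j hj).ne_bot⟩
    rw [mderiv_sub_const htail]
    exact hf.singleSignedOn j hj

theorem IsAdmissible.intervalPartition_axisLine (hf : IsAdmissible A β N x₀ D X U f)
    (hk : β k ≠ 0) (x : Fin n → ℝ) :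
    IntervalPartition (fun _ => True) A (axisLine x k ⁻¹' X) :=
  IsUnionOfIntervals.intervalPartition (hf.slicesIn k hk x)

theorem IsAdmissible.derivChainOn_axisLine (hf : IsAdmissible A β N x₀ D X U f) (k : Fin n)
    (x : Fin n → ℝ) :
    DerivChainOn (fun i t => (pderiv k)^[i] f (axisLine x k t)) (axisLine x k ⁻¹' X) :=
  PolyPhase.derivChainOn_axisLine hf.isOpen hf.subset hf.contDiffOn k x

theorem IsAdmissible.nullMeasurableSet_inter_preimage (hf : IsAdmissible A β N x₀ D X U f)
    (k : Fin n) (m : ℕ) (δ : ℝ) {B : Set ℝ} (hB : MeasurableSet B) :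
    NullMeasurableSet (X ∩ {x | δ ≤ |(pderiv k)^[m] f x|} ∩ f ⁻¹' B) := by
  have hderiv := (contDiffOn_iterate_pderiv hf.isOpen hf.contDiffOn k m).continuousOn
  exact PolyPhase.nullMeasurableSet_inter_preimage
    (PolyPhase.nullMeasurableSet_inter_preimage hf.nullMeasurableSet hf.isOpen hf.subset
      hderiv.abs measurableSet_Ici)
    hf.isOpen (inter_subset_left.trans hf.subset) hf.contDiffOn.continuousOn hB

theorem exists_volume_axisLine_sublevel_le (A : ℕ) (N : Fin n → ℕ) (hγ : ∀ i, k ≤ i → γ i = 0)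
    (hm : m ≠ 0) (hN : IsSignIndex (γ + Pi.single k m) k → m < N k) :
    ∃ C : ℝ, 0 ≤ C ∧ ∀ x₀ D X U f, IsAdmissible A (γ + Pi.single k m) N x₀ D X U f →
      ∀ x μ, 0 < μ → volume (axisLine x k ⁻¹' (X ∩ {y | μ ^ (∑ i, γ i) ≤ |(pderiv k)^[m] f y|} ∩
        {y | |f y| < μ ^ (∑ i, γ i) * μ ^ m})) ≤ ENNReal.ofReal (C * μ) := by
  have hk : (γ + Pi.single k m : Fin n → ℕ) k ≠ 0 := by simp [hm]
  have hβ : ∀ i, k < i → (γ + Pi.single k m : Fin n → ℕ) i = 0 := fun i hi => by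
    simp [hγ i hi.le, hi.ne']
  rcases eq_or_ne γ 0 with rfl | hγ0
  · obtain ⟨C, hC, H⟩ := exists_volume_sublevel_le_of_forall_le_abs A m
    refine ⟨C, hC, fun x₀ D X U f hf x μ hμ => ?_⟩
    refine (measure_mono ?_).trans (H _ _ _ 1 μ (hf.intervalPartition_axisLine hk x)
      (hf.derivChainOn_axisLine k x) one_pos hμ.le fun t ht => ?_)
    · rintro t ⟨⟨htX, -⟩, ht⟩
      exact ⟨htX, by simpa using ht⟩
    · simpa only [zero_add, mderiv_single] using hf.one_le_abs_mderiv _ ht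
  · have hsign := isSignIndex_add_single hγ hγ0 hm
    obtain ⟨C, hC, H⟩ := exists_volume_sublevel_le_of_singleSigned A (hN hsign)
    refine ⟨C, hC, fun x₀ D X U f hf x μ hμ => ?_⟩
    refine H _ _ _ (μ ^ (∑ i, γ i)) μ (hf.intervalPartition_axisLine hk x)
      (hf.derivChainOn_axisLine k x)
      (fun J hJ _ => (SingleSignedOn.preimage ?_ _).mono hJ) (by positivity) hμ.le
    rw [← mderiv_tailIndex hβ N]
    exact hf.singleSignedOn k hsign

theorem exists_volume_sublevel_le (A : ℕ) (β : Fin n → ℕ) :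
    ∀ N : Fin n → ℕ, (∀ j, IsSignIndex β j → β j < N j) → ∃ C : ℝ, 0 ≤ C ∧
      ∀ x₀ D X U f, IsAdmissible A β N x₀ D X U f → ∀ μ, 0 < μ →
        volume (X ∩ {x | |f x| < μ ^ (∑ i, β i)}) ≤
          ENNReal.ofReal (C * μ * (2 * D) ^ (n - 1)) := by
  induction β using multiIndex_induction with
  | zero =>
    refine fun N _ => ⟨0, le_rfl, fun x₀ D X U f hf μ _ => ?_⟩
    have hempty : X ∩ {x | |f x| < μ ^ (∑ i, (0 : Fin n → ℕ) i)} = ∅ := by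
      refine eq_empty_of_forall_notMem fun x ⟨hx, hlt⟩ => ?_
      have hge := hf.one_le_abs_mderiv x hx
      rw [mderiv_zero] at hge
      simp only [Pi.zero_apply, Finset.sum_const_zero, pow_zero, mem_ofPred_eq] at hlt
      exact hlt.not_ge hge
    rw [hempty, measure_empty]
    exact zero_le
  | add_single γ k m hm hγ ih =>
    intro N hN
    have hNγ : ∀ j, IsSignIndex γ j → N j = N j + (Pi.single k m : Fin n → ℕ) j := fun j hj => by
      have hjk : j ≠ k := fun h => hj.1 (hγ j h.ge)
      rw [Pi.single_eq_of_ne hjk, add_zero]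
    obtain ⟨C₁, hC₁, H₁⟩ := ih N fun j hj =>
      (Nat.le_add_right _ _).trans_lt (hN j (hj.mono le_self_add))
    obtain ⟨C₂, hC₂, H₂⟩ := exists_volume_axisLine_sublevel_le A N hγ hm fun hk => by
      simpa [hγ k le_rfl] using hN k hk
    refine ⟨C₁ + C₂, by positivity, fun x₀ D X U f hf μ hμ => ?_⟩
    have hD := hf.nonneg
    rw [sum_add_single, pow_add]
    set δ := μ ^ (∑ i, γ i)
    set g := (pderiv k)^[m] f
    have hcover : X ∩ {x | |f x| < δ * μ ^ m} ⊆
        X ∩ {x | |g x| < δ} ∪ X ∩ {x | δ ≤ |g x|} ∩ {x | |f x| < δ * μ ^ m} :=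
      fun x ⟨hx, hfx⟩ => (lt_or_ge |g x| δ).imp (fun h => ⟨hx, h⟩) fun h => ⟨⟨hx, h⟩, hfx⟩
    have hnull : NullMeasurableSet (X ∩ {x | δ ≤ |g x|} ∩ {x | |f x| < δ * μ ^ m}) :=
      hf.nullMeasurableSet_inter_preimage k m δ
        (measurableSet_lt continuous_abs.measurable measurable_const)
    have hgood := H₁ x₀ D X U g (hf.iterate_pderiv (fun i hi => hγ i hi.le) hNγ) μ hμ
    have hbad := volume_le_of_axisLine k hnull hD (by positivity : 0 ≤ C₂ * μ)
      ((inter_subset_left.trans inter_subset_left).trans hf.subset_cube)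
      fun x => H₂ x₀ D X U f hf x μ hμ
    calc volume (X ∩ {x | |f x| < δ * μ ^ m})
        ≤ ENNReal.ofReal (C₁ * μ * (2 * D) ^ (n - 1)) +
            ENNReal.ofReal (C₂ * μ * (2 * D) ^ (n - 1)) :=
          (measure_mono hcover).trans ((measure_union_le _ _).trans (add_le_add hgood hbad))
      _ = ENNReal.ofReal ((C₁ + C₂) * μ * (2 * D) ^ (n - 1)) := by
          rw [← ENNReal.ofReal_add (by positivity) (by positivity)]
          ring_nf

theorem exists_volume_sublevel_pderiv_le (A : ℕ) (hγ : ∀ i, k < i → γ i = 0)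
    (hN : ∀ j, IsSignIndex (γ + Pi.single k 1) j → (γ + Pi.single k 1 : Fin n → ℕ) j < N j) :
    ∃ C : ℝ, 0 ≤ C ∧ ∀ x₀ D X U f, IsAdmissible A (γ + Pi.single k 1) N x₀ D X U f →
      ∀ μ, 0 < μ → volume (X ∩ {x | |pderiv k f x| < μ ^ (∑ i, γ i)}) ≤
        ENNReal.ofReal (C * μ * (2 * D) ^ (n - 1)) := by
  have hN' : ∀ j, IsSignIndex γ j →
      N j = (N - Pi.single k 1 : Fin n → ℕ) j + (Pi.single k 1 : Fin n → ℕ) j := fun j hj =>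
    (Nat.sub_add_cancel ((Nat.le_add_left _ _).trans (hN j (hj.mono le_self_add)).le)).symm
  obtain ⟨C, hC, H⟩ := exists_volume_sublevel_le A γ (N - Pi.single k 1) fun j hj =>
    Nat.lt_sub_iff_add_lt.2 (hN j (hj.mono le_self_add))
  exact ⟨C, hC, fun x₀ D X U f hf => H x₀ D X U (pderiv k f) (hf.iterate_pderiv (m := 1) hγ hN')⟩

end Sublevel

section Oscillatory

variable {n : ℕ} {β N : Fin n → ℕ} {k : Fin n}

theorem exists_singleSignedOn_axisLine (A : ℕ) (hk : β k ≠ 0) (hβ : ∀ i, k < i → β i = 0)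
    (hN : IsSignIndex β k ∨ β = Pi.single k 1 → β k < N k) :
    ∃ N₀, 2 ≤ N₀ ∧ ∀ x₀ D X U f, IsAdmissible A β N x₀ D X U f →
      (β = Pi.single k 1 → SingleSignedOn (mderiv (tailIndex β N k) f) X) →
      ∀ x, ∀ J ⊆ axisLine x k ⁻¹' X, J.OrdConnected →
        SingleSignedOn (fun t => (pderiv k)^[N₀] f (axisLine x k t)) J := by
  by_cases h : IsSignIndex β k ∨ β = Pi.single k 1
  · refine ⟨N k, Nat.succ_le_of_lt ((Nat.one_le_iff_ne_zero.2 hk).trans_lt (hN h)),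
      fun x₀ D X U f hf hsingle x J hJ _ => ?_⟩
    have hX := h.elim (hf.singleSignedOn k) hsingle
    rw [mderiv_tailIndex hβ] at hX
    exact (hX.preimage _).mono hJ
  · obtain ⟨hsign, hone⟩ := not_or.1 h
    have hβk : β = Pi.single k (β k) := by
      ext i
      rcases lt_trichotomy i k with hi | rfl | hi
      · rw [Pi.single_eq_of_ne hi.ne]
        by_contra h0
        exact hsign ⟨hk, i, hi, h0⟩
      · rw [Pi.single_eq_same]
      · rw [Pi.single_eq_of_ne hi.ne', hβ i hi]
    have hk1 : β k ≠ 1 := fun h1 => hone (hβk.trans (by rw [h1]))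
    refine ⟨β k, by omega, fun x₀ D X U f hf _ x J hJ hJc => ?_⟩
    refine singleSignedOn_of_ne_zero hJc
      (((hf.derivChainOn_axisLine k x).mono hJ).continuousOn _) fun t ht h0 => ?_
    have hge := hf.one_le_abs_mderiv _ (hJ ht)
    rw [hβk, mderiv_single, h0, abs_zero] at hge
    exact hge.not_gt one_pos

theorem exists_norm_setIntegral_cexp_le (A m : ℕ) (hk : β k ≠ 0) (hβ : ∀ i, k < i → β i = 0)
    (hN : IsSignIndex β k ∨ β = Pi.single k 1 → β k < N k) :
    ∃ C : ℝ, 0 ≤ C ∧ ∀ x₀ D X U f, IsAdmissible A β N x₀ D X U f →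
      (β = Pi.single k 1 → SingleSignedOn (mderiv (tailIndex β N k) f) X) →
      ∀ (P : Polynomial ℝ) (s η lam : ℝ), P.derivative.natDegree ≤ m → 0 < s → 0 < η → lam ≠ 0 →
        ‖∫ x in X ∩ {x | η ≤ |pderiv k f x|} ∩ f ⁻¹' {t | s ≤ |P.derivative.eval t|},
          Complex.exp (Complex.I * ((lam * P.eval (f x) : ℝ) : ℂ))‖ ≤
            C / (|lam| * s * η) * (2 * D) ^ (n - 1) := by
  obtain ⟨N₀, hN₀, hsign⟩ := exists_singleSignedOn_axisLine A hk hβ hN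
  obtain ⟨C, hC, H⟩ := exists_norm_integral_indicator_cexp_le A m hN₀
  refine ⟨C, hC, fun x₀ D X U f hf hsingle P s η lam hP hs hη hlam => ?_⟩
  have hnull : NullMeasurableSet
      (X ∩ {x | η ≤ |pderiv k f x|} ∩ f ⁻¹' {t | s ≤ |P.derivative.eval t|}) :=
    hf.nullMeasurableSet_inter_preimage k 1 η
      (measurableSet_le measurable_const P.derivative.continuous.abs.measurable)
  rw [← integral_indicator₀ hnull]
  refine norm_integral_le_of_axisLine k hf.nonneg (support_indicator_subset.trans
    ((inter_subset_left.trans inter_subset_left).trans hf.subset_cube)) fun x => ?_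
  exact H _ _ _ P s η lam (hf.intervalPartition_axisLine hk x)
    ((isBounded_axisLine_preimage_cube x₀ x D k).subset (preimage_mono hf.subset_cube))
    (hf.derivChainOn_axisLine k x) (hsign x₀ D X U f hf hsingle x) hP hs hη hlam

theorem exists_abs_sub_lt_of_abs_eval_lt (m : ℕ) :
    ∃ K : ℝ, 1 ≤ K ∧ ∀ Q : Polynomial ℝ, Q.natDegree = m → (Q.Monic ∨ IsSND Q) →
      ∀ ε, 0 < ε → ε ≤ 1 → ∀ J : Set ℝ, J.OrdConnected → (∀ t ∈ J, |Q.eval t| < ε ^ m / K) →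
        ∀ x ∈ J, ∀ y ∈ J, |x - y| < ε := by
  obtain ⟨K, hK, H⟩ := exists_pow_le_mul_abs_eval m
  refine ⟨K, hK, fun Q hQ hQ' ε hε hε1 J hJ hlt => ?_⟩
  have hclose : ∀ x ∈ J, ∀ y ∈ J, y - x < ε := fun x hx y hy => by
    by_contra! hle
    obtain ⟨t, ht, hge⟩ := H Q hQ hQ' ε hε hε1 x
    have htJ : t ∈ J := hJ.out hx hy ⟨ht.1, ht.2.trans (by linarith)⟩
    exact ((lt_div_iff₀' (one_pos.trans_le hK)).1 (hlt t htJ)).not_ge hge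
  exact fun x hx y hy => abs_sub_lt_iff.2 ⟨hclose y hy x hx, hclose x hx y hy⟩

theorem exists_volume_preimage_abs_eval_lt_le (A m : ℕ) (hβ : β ≠ 0)
    (hN : ∀ j, IsSignIndex β j → β j < N j) :
    ∃ C K : ℝ, 0 ≤ C ∧ 1 ≤ K ∧ ∀ x₀ D X U f, IsAdmissible A β N x₀ D X U f →
      ∀ Q : Polynomial ℝ, Q.natDegree = m → (Q.Monic ∨ IsSND Q) → ∀ μ, 0 < μ → μ ≤ 1 →
        volume (X ∩ f ⁻¹' {t | |Q.eval t| < (μ ^ (∑ i, β i)) ^ m / K}) ≤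
          ENNReal.ofReal (C * μ * (2 * D) ^ (n - 1)) := by
  obtain ⟨C, hC, H⟩ := exists_volume_sublevel_le A β N hN
  obtain ⟨K, hK, hclose⟩ := exists_abs_sub_lt_of_abs_eval_lt m
  refine ⟨(2 ^ (m + 1) : ℕ) * C, K, by positivity, hK, fun x₀ D X U f hf Q hQ hQ' μ hμ hμ1 => ?_⟩
  have hinterval : ∀ J ⊆ {t | |Q.eval t| < (μ ^ (∑ i, β i)) ^ m / K}, J.OrdConnected → True →
      volume (X ∩ f ⁻¹' J) ≤ ENNReal.ofReal (C * μ * (2 * D) ^ (n - 1)) := fun J hJ hJc _ => by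
    rcases J.eq_empty_or_nonempty with rfl | ⟨t₀, ht₀⟩
    · simp
    have hsub : X ∩ f ⁻¹' J ⊆ X ∩ {x | |f x - t₀| < μ ^ (∑ i, β i)} := fun x ⟨hx, hxJ⟩ =>
      ⟨hx, hclose Q hQ hQ' _ (by positivity) (pow_le_one₀ hμ.le hμ1) J hJc hJ _ hxJ _ ht₀⟩
    exact (measure_mono hsub).trans (H x₀ D X U _ (hf.sub_const hβ hN t₀) μ hμ)
  refine ((IntervalPartition.polynomial_abs_lt hQ.le _).measure_inter_preimage_le
    hinterval).trans_eq ?_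
  rw [← ENNReal.ofReal_natCast, ← ENNReal.ofReal_mul (by positivity)]
  ring_nf

theorem norm_setIntegral_cexp_le_of_volume_le {E : Type*} [MeasurableSpace E] {ν : Measure E}
    {Y : Set E} {M : ℝ} (hM : 0 ≤ M) (hY : ν Y ≤ ENNReal.ofReal M) (φ : E → ℝ) :
    ‖∫ x in Y, Complex.exp (Complex.I * (φ x : ℂ)) ∂ν‖ ≤ M := by
  have hle := norm_setIntegral_le_of_norm_le_const (C := 1) (hY.trans_lt ENNReal.ofReal_lt_top)
    fun x _ => (norm_cexp_I_mul_ofReal (φ x)).le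
  rw [one_mul] at hle
  exact hle.trans (ENNReal.toReal_le_of_le_ofReal hM hY)

theorem IsAdmissible.volume_le {A : ℕ} {x₀ : Fin n → ℝ} {D : ℝ}
    {X U : Set (EuclideanSpace ℝ (Fin n))} {f : EuclideanSpace ℝ (Fin n) → ℝ}
    (hf : IsAdmissible A β N x₀ D X U f) : volume X ≤ ENNReal.ofReal ((2 * D) ^ n) :=
  (measure_mono hf.subset_cube).trans_eq (volume_cube x₀ hf.nonneg)

theorem IsAdmissible.integrableOn_cexp {A : ℕ} {x₀ : Fin n → ℝ} {D : ℝ}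
    {X U : Set (EuclideanSpace ℝ (Fin n))} {f : EuclideanSpace ℝ (Fin n) → ℝ}
    (hf : IsAdmissible A β N x₀ D X U f) {φ : ℝ → ℝ} (hφ : Continuous φ) :
    IntegrableOn (fun x => Complex.exp (Complex.I * (φ (f x) : ℂ))) X := by
  have hcont : ContinuousOn (fun x => Complex.exp (Complex.I * (φ (f x) : ℂ))) U :=
    (by fun_prop : Continuous fun t => Complex.exp (Complex.I * (φ t : ℂ))).comp_continuousOn
      hf.contDiffOn.continuousOn
  exact .of_bound (hf.volume_le.trans_lt ENNReal.ofReal_lt_top)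
    ((hcont.aestronglyMeasurable hf.isOpen.measurableSet).mono_measure
      (Measure.restrict_mono hf.subset le_rfl)) 1
    (.of_forall fun x => (norm_cexp_I_mul_ofReal _).le)

end Oscillatory

section Combined

variable {n : ℕ} {β N : Fin n → ℕ}

theorem exists_eq_add_single_one (hβ : β ≠ 0) :
    ∃ (γ : Fin n → ℕ) (k : Fin n), (∀ i, k < i → γ i = 0) ∧ β = γ + Pi.single k 1 := by
  obtain ⟨γ, k, m, hm, hγ, rfl⟩ := exists_eq_add_single hβ
  obtain ⟨m, rfl⟩ := Nat.exists_eq_succ_of_ne_zero hm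
  refine ⟨γ + Pi.single k m, k, fun i hi => ?_, by rw [add_assoc, ← Pi.single_add]⟩
  rw [Pi.add_apply, hγ i hi.le, Pi.single_eq_of_ne hi.ne', add_zero]

theorem exists_volume_sdiff_le (A m : ℕ) {γ : Fin n → ℕ} {k : Fin n} (hγ : ∀ i, k < i → γ i = 0)
    (hβ : β = γ + Pi.single k 1) (hN : ∀ j, IsSignIndex β j → β j < N j) :
    ∃ C K : ℝ, 0 ≤ C ∧ 1 ≤ K ∧ ∀ x₀ D X U f, IsAdmissible A β N x₀ D X U f →
      ∀ Q : Polynomial ℝ, Q.natDegree = m → (Q.Monic ∨ IsSND Q) → ∀ μ, 0 < μ → μ ≤ 1 →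
        volume (X \ (X ∩ {x | μ ^ (∑ i, γ i) ≤ |pderiv k f x|} ∩
          f ⁻¹' {t | (μ ^ (∑ i, β i)) ^ m / K ≤ |Q.eval t|})) ≤
            ENNReal.ofReal (C * μ * (2 * D) ^ (n - 1)) := by
  have hβ0 : β ≠ 0 := Function.ne_iff.2 ⟨k, by simp [hβ]⟩
  obtain ⟨C₁, hC₁, H₁⟩ := exists_volume_sublevel_pderiv_le A hγ (hβ ▸ hN)
  obtain ⟨C₂, K, hC₂, hK, H₂⟩ := exists_volume_preimage_abs_eval_lt_le A m hβ0 hN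
  refine ⟨C₁ + C₂, K, by positivity, hK, fun x₀ D X U f hf Q hQ hQ' μ hμ hμ1 => ?_⟩
  have hD := hf.nonneg
  set η := μ ^ (∑ i, γ i)
  set s := (μ ^ (∑ i, β i)) ^ m / K
  have hcover : X \ (X ∩ {x | η ≤ |pderiv k f x|} ∩ f ⁻¹' {t | s ≤ |Q.eval t|}) ⊆
      X ∩ {x | |pderiv k f x| < η} ∪ X ∩ f ⁻¹' {t | |Q.eval t| < s} := fun x ⟨hx, hx'⟩ => by
    rcases lt_or_ge |pderiv k f x| η with hη | hη
    · exact .inl ⟨hx, hη⟩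
    rcases lt_or_ge |Q.eval (f x)| s with hs | hs
    · exact .inr ⟨hx, hs⟩
    · exact absurd ⟨⟨hx, hη⟩, hs⟩ hx'
  calc volume (X \ (X ∩ {x | η ≤ |pderiv k f x|} ∩ f ⁻¹' {t | s ≤ |Q.eval t|}))
      ≤ ENNReal.ofReal (C₁ * μ * (2 * D) ^ (n - 1)) +
          ENNReal.ofReal (C₂ * μ * (2 * D) ^ (n - 1)) :=
        (measure_mono hcover).trans ((measure_union_le _ _).trans
          (add_le_add (H₁ x₀ D X U f (hβ ▸ hf) μ hμ) (H₂ x₀ D X U f hf Q hQ hQ' μ hμ hμ1)))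
    _ = ENNReal.ofReal ((C₁ + C₂) * μ * (2 * D) ^ (n - 1)) := by
        rw [← ENNReal.ofReal_add (by positivity) (by positivity)]
        ring_nf

theorem exists_norm_integral_le_of_mul_pow_eq_one (A m : ℕ) (hβ : β ≠ 0)
    (hN : ∀ j, IsSignIndex β j ∨ β = Pi.single j 1 → β j < N j) :
    ∃ C : ℝ, 0 ≤ C ∧ ∀ x₀ D X U f, IsAdmissible A β N x₀ D X U f →
      (∀ j, β = Pi.single j 1 → SingleSignedOn (mderiv (tailIndex β N j) f) X) →
      ∀ P : Polynomial ℝ, P.derivative.natDegree = m →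
        (P.derivative.Monic ∨ IsSND P.derivative) →
      ∀ lam μ : ℝ, 0 < μ → μ ≤ 1 → |lam| * μ ^ ((∑ i, β i) * (m + 1)) = 1 →
        ‖∫ x in X, Complex.exp (Complex.I * ((lam * P.eval (f x) : ℝ) : ℂ))‖ ≤
          C * μ * (2 * D) ^ (n - 1) := by
  obtain ⟨γ, k, hγ, hβγ⟩ := exists_eq_add_single_one hβ
  have hβk : β k ≠ 0 := by simp [hβγ]
  have hβlt : ∀ i, k < i → β i = 0 := fun i hi => by simp [hβγ, hγ i hi, hi.ne']
  obtain ⟨C₁, K, hC₁, hK, hbad⟩ := exists_volume_sdiff_le A m hγ hβγ fun j hj => hN j (.inl hj)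
  obtain ⟨C₂, hC₂, hgood⟩ := exists_norm_setIntegral_cexp_le A m hβk hβlt (hN k)
  refine ⟨C₂ * K + C₁, by positivity,
    fun x₀ D X U f hf hsingle P hP hP' lam μ hμ hμ1 hlam => ?_⟩
  have hD := hf.nonneg
  have hlam0 : lam ≠ 0 := fun h => by simp [h] at hlam
  set η := μ ^ (∑ i, γ i) with hη
  set s := (μ ^ (∑ i, β i)) ^ m / K with hs
  have hscale : C₂ / (|lam| * s * η) = C₂ * K * μ := by
    have hexp : (∑ i, β i) * (m + 1) = (∑ i, β i) * m + ∑ i, γ i + 1 := by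
      rw [hβγ, sum_add_single]
      ring
    have hprod : |lam| * s * η * (K * μ) = 1 := by
      rw [← hlam, hexp, hs, hη, pow_succ, pow_add, pow_mul]
      field_simp
    rw [div_eq_iff (by positivity), mul_assoc C₂, mul_assoc C₂, mul_comm (K * μ), hprod, mul_one]
  set G := X ∩ {x | η ≤ |pderiv k f x|} ∩ f ⁻¹' {t | s ≤ |P.derivative.eval t|}
  have hGX : G ⊆ X := inter_subset_left.trans inter_subset_left
  have hGnull : NullMeasurableSet G := hf.nullMeasurableSet_inter_preimage k 1 η
    (measurableSet_le measurable_const P.derivative.continuous.abs.measurable)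
  have hsplit := integral_inter_add_sdiff₀ hGnull
    (hf.integrableOn_cexp (by fun_prop : Continuous fun t => lam * P.eval t))
  rw [inter_eq_self_of_subset_right hGX] at hsplit
  rw [← hsplit]
  calc _ ≤ C₂ / (|lam| * s * η) * (2 * D) ^ (n - 1) + C₁ * μ * (2 * D) ^ (n - 1) :=
        norm_add_le_of_le
          (hgood x₀ D X U f hf (hsingle k) P s η lam hP.le (by positivity) (by positivity) hlam0)
          (norm_setIntegral_cexp_le_of_volume_le (by positivity)
            (hbad x₀ D X U f hf _ hP hP' μ hμ hμ1) _)
    _ = (C₂ * K + C₁) * μ * (2 * D) ^ (n - 1) := by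
        rw [hscale]
        ring

theorem exists_norm_integral_le (A m : ℕ) (hβ : β ≠ 0)
    (hN : ∀ j, IsSignIndex β j ∨ β = Pi.single j 1 → β j < N j) :
    ∃ K : ℝ, 0 ≤ K ∧ ∀ x₀ D X U f, IsAdmissible A β N x₀ D X U f →
      (∀ j, β = Pi.single j 1 → SingleSignedOn (mderiv (tailIndex β N j) f) X) →
      ∀ P : Polynomial ℝ, P.derivative.natDegree = m →
        (P.derivative.Monic ∨ IsSND P.derivative) →
      ∀ lam : ℝ, lam ≠ 0 →
        ‖∫ x in X, Complex.exp (Complex.I * ((lam * P.eval (f x) : ℝ) : ℂ))‖ ≤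
          K * (D ^ (n - 1) + D ^ n) *
            |lam| ^ (-(1 / (((∑ i, β i : ℕ) : ℝ) * ((m + 1 : ℕ) : ℝ)))) := by
  obtain ⟨C, hC, H⟩ := exists_norm_integral_le_of_mul_pow_eq_one A m hβ hN
  refine ⟨C * 2 ^ (n - 1) + 2 ^ n, by positivity,
    fun x₀ D X U f hf hsingle P hP hP' lam hlam => ?_⟩
  have hD := hf.nonneg
  have hlam0 : 0 < |lam| := abs_pos.2 hlam
  have hb : ((∑ i, β i : ℕ) : ℝ) ≠ 0 := by
    obtain ⟨γ, k, -, rfl⟩ := exists_eq_add_single_one hβ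
    rw [sum_add_single]
    positivity
  set μ := |lam| ^ (-(1 / (((∑ i, β i : ℕ) : ℝ) * ((m + 1 : ℕ) : ℝ)))) with hμ
  have hμ0 : 0 < μ := by positivity
  have hscale : |lam| * μ ^ ((∑ i, β i) * (m + 1)) = 1 := by
    rw [hμ, ← Real.rpow_natCast, ← Real.rpow_mul hlam0.le, Nat.cast_mul, neg_mul,
      one_div_mul_cancel (mul_ne_zero hb (Nat.cast_ne_zero.2 m.succ_ne_zero)), Real.rpow_neg_one,
      mul_inv_cancel₀ hlam0.ne']
  rcases le_total μ 1 with hμ1 | hμ1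
  · calc _ ≤ C * μ * (2 * D) ^ (n - 1) := H x₀ D X U f hf hsingle P hP hP' lam μ hμ0 hμ1 hscale
      _ = C * 2 ^ (n - 1) * D ^ (n - 1) * μ := by rw [mul_pow]; ring
      _ ≤ _ := by
        gcongr
        · exact le_add_of_nonneg_right (by positivity)
        · exact le_add_of_nonneg_right (by positivity)
  · calc _ ≤ (2 * D) ^ n := norm_setIntegral_cexp_le_of_volume_le (by positivity) hf.volume_le _
      _ = 2 ^ n * D ^ n * 1 := by rw [mul_pow, mul_one]
      _ ≤ _ := by
        gcongr
        · exact le_add_of_nonneg_left (by positivity)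
        · exact le_add_of_nonneg_left (by positivity)

theorem natDegree_ne_zero_of_derivative {P : Polynomial ℝ}
    (hP : P.derivative.Monic ∨ IsSND P.derivative) : P.natDegree ≠ 0 := by
  intro h0
  rw [Polynomial.eq_C_of_natDegree_eq_zero h0, Polynomial.derivative_C] at hP
  rcases hP with h | ⟨-, j, -, h⟩
  · exact zero_ne_one h
  · simp at h

end Combined

end PolyPhase

open PolyPhase MeasureTheory in
theorem theorem2p4_general (n : ℕ) (β : Fin n → ℕ) (hβ : β ≠ 0) (N : Fin n → ℕ)
    (hN : ∀ j, IsSignIndex β j ∨ β = Pi.single j 1 → β j < N j) (A d : ℕ) :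
    ∃ K : ℝ, 0 ≤ K ∧
      ∀ X : Set (EuclideanSpace ℝ (Fin n)), Bornology.IsBounded X → NullMeasurableSet X →
        (∀ j, β j ≠ 0 → SlicesIn j A X) →
      ∀ (U : Set (EuclideanSpace ℝ (Fin n))) (f : EuclideanSpace ℝ (Fin n) → ℝ),
        IsOpen U → X ⊆ U → ContDiffOn ℝ ∞ f U → (∀ x ∈ X, 1 ≤ |mderiv β f x|) →
        (∀ j, IsSignIndex β j ∨ β = Pi.single j 1 →
          SingleSignedOn (mderiv (tailIndex β N j) f) X) →
      ∀ P : Polynomial ℝ, P.natDegree = d → (P.derivative.Monic ∨ IsSND P.derivative) →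
      ∀ lam : ℝ, lam ≠ 0 →
        ‖∫ x in X, Complex.exp (Complex.I * ((lam * P.eval (f x) : ℝ) : ℂ))‖ ≤
          K * (Metric.diam X ^ (n - 1) + Metric.diam X ^ n) *
            |lam| ^ (-(1 / (((∑ i, β i : ℕ) : ℝ) * (d : ℝ)))) := by
  rcases d with _ | m
  · exact ⟨0, le_rfl, fun _ _ _ _ _ _ _ _ _ _ _ P hP hP' =>
      absurd hP (natDegree_ne_zero_of_derivative hP')⟩
  obtain ⟨K, hK, H⟩ := exists_norm_integral_le A m hβ hN
  refine ⟨K, hK, fun X hXb hX hslices U f hU hXU hf hone hsign P hP hP' => ?_⟩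
  rcases X.eq_empty_or_nonempty with rfl | ⟨x₀, hx₀⟩
  · intro lam _
    rw [setIntegral_empty, norm_zero]
    positivity
  have hadm : IsAdmissible A β N x₀ (Metric.diam X) X U f :=
    ⟨hX, Metric.diam_nonneg, subset_cube_diam hXb hx₀, hslices, hU, hXU, hf, hone,
      fun j hj => hsign j (.inl hj)⟩
  have hdeg : P.derivative.natDegree = m := by
    rw [Polynomial.natDegree_derivative, hP, Nat.add_sub_cancel]
  exact H x₀ _ X U f hadm (fun j hj => hsign j (.inr hj)) P hdeg hP'

theorem theorem2p4 (n : ℕ) (hn : 2 ≤ n) (β : Fin n → ℕ) (hβ : β ≠ 0) (N : Fin n → ℕ)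
    (hN : ∀ j : Fin n, (0 < (j : ℕ) ∨ β = Pi.single j 1) → β j < N j) (A d : ℕ) :
    ∃ C : ℝ → ℝ, (∀ R : ℝ, BddAbove (C '' Set.Icc 0 R)) ∧
      ∀ X : Set (EuclideanSpace ℝ (Fin n)),
        Bornology.IsBounded X →
        MeasureTheory.NullMeasurableSet X MeasureTheory.volume →
        (∀ j : Fin n, (0 < (j : ℕ) ∨ 0 < β j) → PolyPhase.SlicesIn j A X) →
      ∀ (U : Set (EuclideanSpace ℝ (Fin n))) (f : EuclideanSpace ℝ (Fin n) → ℝ),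
        IsOpen U → X ⊆ U → ContDiffOn ℝ ∞ f U →
        (∀ x ∈ X, 1 ≤ |PolyPhase.mderiv β f x|) →
        (∀ j : Fin n, (0 < (j : ℕ) ∨ β = Pi.single j 1) →
          PolyPhase.SingleSignedOn (PolyPhase.mderiv (PolyPhase.tailIndex β N j) f) X) →
      ∀ P : Polynomial ℝ, P.natDegree = d →
        (P.derivative.Monic ∨ PolyPhase.IsSND P.derivative) →
      ∀ lam : ℝ, lam ≠ 0 →
        ‖∫ x in X, Complex.exp (Complex.I * ((lam * P.eval (f x) : ℝ) : ℂ))‖ ≤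
          C (Metric.diam X) * |lam| ^ (-(1 / (((∑ i, β i : ℕ) : ℝ) * (d : ℝ)))) := by
  have hsign : ∀ j, PolyPhase.IsSignIndex β j ∨ β = Pi.single j 1 →
      0 < (j : ℕ) ∨ β = Pi.single j 1 := fun j =>
    .imp_left fun ⟨_, _, hij, _⟩ => (Nat.zero_le _).trans_lt (Fin.lt_def.1 hij)
  obtain ⟨K, -, H⟩ := theorem2p4_general n β hβ N (fun j hj => hN j (hsign j hj)) A d
  refine ⟨fun R => K * (R ^ (n - 1) + R ^ n),
    fun R => isCompact_Icc.bddAbove_image (by fun_prop), ?_⟩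
  intro X hXb hX hslices U f hU hXU hf hone hsgn
  exact H X hXb hX (fun j hj => hslices j (.inr (Nat.pos_of_ne_zero hj))) U f hU hXU hf hone
    fun j hj => hsgn j (hsign j hj)
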